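/- There is an absolute constant $\delta>0$ with the following property. Let $G$ be a finite simple bipartite graph on $n$ vertices with maximum degree at most $3$, no connected component of which is isomorphic to the Heawood graph (the bipartite incidence graph of the points and lines of the Fano plane). Let $\lambda_1(G)\ge\lambda_2(G)\ge\cdots\ge\lambda_n(G)$ be the eigenvalues of the adjacency matrix of $G$, listed with multiplicity. Then for every integer $i$ with $1\le i\le n$ and $(\tfrac12-\delta)n\le i\le(\tfrac12+\delta)n$ we have $\lambda_i(G)\in[-1,1]$. -/

import Mathlib

/-- Incidence in the Fano plane. Points and lines are both labelled by the integers mod `7`, and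
the line `l` consists of the three points `l`, `l + 1`, `l + 3`. -/
def FanoIncident (p l : ZMod 7) : Prop :=
  p = l ∨ p = l + 1 ∨ p = l + 3

instance : DecidableRel FanoIncident := fun p l =>
  inferInstanceAs (Decidable (p = l ∨ p = l + 1 ∨ p = l + 3))

/-- Any two distinct points of the Fano plane lie on exactly one common line. -/
theorem fano_existsUnique_line :
    ∀ p q : ZMod 7, p ≠ q → ∃! l : ZMod 7, FanoIncident p l ∧ FanoIncident q l := by
  unfold ExistsUnique
  decide

/-- Any two distinct lines of the Fano plane have exactly one common point. -/
theorem fano_existsUnique_point :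
    ∀ l m : ZMod 7, l ≠ m → ∃! p : ZMod 7, FanoIncident p l ∧ FanoIncident p m := by
  unfold ExistsUnique
  decide

/-- The Heawood graph: the bipartite incidence graph of the points (left summand) and the lines
(right summand) of the Fano plane. -/
def heawoodGraph : SimpleGraph (ZMod 7 ⊕ ZMod 7) where
  Adj
    | Sum.inl p, Sum.inr l => FanoIncident p l
    | Sum.inr l, Sum.inl p => FanoIncident p l
    | _, _ => False
  symm := ⟨by
    rintro (p | l) (q | m) h
    · exact h
    · exact h
    · exact h
    · exact h⟩
  loopless := ⟨by
    rintro (p | l) h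
    · exact h
    · exact h⟩

/-- The adjacency matrix of a graph over `ℝ` is Hermitian. -/
theorem isHermitian_adjMatrix_real {V : Type*} (G : SimpleGraph V) [DecidableRel G.Adj] :
    (G.adjMatrix ℝ).IsHermitian := by
  rw [Matrix.IsHermitian, Matrix.conjTranspose_eq_transpose_of_trivial]
  exact G.isSymm_adjMatrix

/-- The eigenvalues of the adjacency matrix of a finite graph, with multiplicity and in
non-increasing order. The index is 0-based: `adjEigenvalue G i` is the eigenvalue usually
written `λ_{i+1}(G)`, where `λ_1(G) ≥ λ_2(G) ≥ ⋯ ≥ λ_n(G)`. -/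
noncomputable def adjEigenvalue {V : Type*} [Fintype V] [DecidableEq V] (G : SimpleGraph V)
    [DecidableRel G.Adj] (i : Fin (Fintype.card V)) : ℝ :=
  (isHermitian_adjMatrix_real G).eigenvalues₀ i

/-! Let `A` be the adjacency matrix and `s` the diagonal sign matrix of the bipartition, so that `A
s = -s A`. If the `k` largest eigenvalues exceed `1`, their eigenvectors together with the images of
these under `s` span a space of dimension `2k` on which `A` strictly increases the norm of every
nonzero vector. This space meets a space `W` on which `A` never increases the norm only in zero, so
`2k + dim W ≤ n`. The same holds for the `k` smallest eigenvalues if they lie below `-1`. A space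
`W` of dimension linear in `n` therefore pushes both kinds of index away from the middle
(`two_mul_card_add_card_le`).

Such a `W` is assembled locally. If every ball of radius `R` supports a nonzero vector that `A` does
not expand, choose one such vector around each of linearly many far apart centres. The vectors are
orthogonal and so are their images, hence no combination of them is expanded
(`exists_separated_finset`, `two_mul_card_add_card_le_of_separated`).

The local claim is `Pattern.not_expandsOn_walkBall`. Some cases are easy: the indicator of a vertex
of degree at most one; the difference of two vertices with two common neighbours, whose image lives
on at most two further vertices; and, around a vertex of a cubic graph with no 4-cycle or 6-cycle
nearby, the vector with `-3` at the vertex and `1` at the six vertices at distance two, where both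
squared norms are `15`. The Heawood graph is a true exception: there `A ^ 2` is `2 I + J` on each
colour class, so every nonzero vector is expanded. The cases in between, mainly degree two and
hexagons, are settled by a finite search. Its branches ask for the next neighbour of a chosen
vertex, and its leaves are explicit integer vectors or configurations excluded before. The search is
stored as `Pattern.certificate`; its soundness is `Pattern.refuted_of_checkSteps`, and the kernel
evaluates the check. -/

/-! ### Dimension count for a matrix that anticommutes with a sign matrix -/

open Matrix in
/-- If a symmetric matrix `A` is anti-invariant under the diagonal sign matrix `s`, then a set `U`
of eigenvalues outside `[-1, 1]`, no two of which sum to zero, contributes `2 * #U` dimensions to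
the space on which `A` expands, which is complementary to any space on which it does not. -/
theorem two_mul_card_add_card_le {V ι : Type*} [Fintype V] [DecidableEq V] [Fintype ι]
    {A : Matrix V V ℝ} (hA : A.IsHermitian) (s : V → ℝ) (hs : ∀ v, s v * s v = 1)
    (hsA : ∀ v w, A v w * s w = -(s v * A v w)) (U : Finset V)
    (hU : ∀ i ∈ U, 1 < hA.eigenvalues i ^ 2)
    (hUU : ∀ i ∈ U, ∀ j ∈ U, hA.eigenvalues i + hA.eigenvalues j ≠ 0)
    (x : ι → V → ℝ) (hx : LinearIndependent ℝ x)
    (hAx : ∀ c : ι → ℝ, (A *ᵥ ∑ k, c k • x k) ⬝ᵥ (A *ᵥ ∑ k, c k • x k) ≤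
      (∑ k, c k • x k) ⬝ᵥ (∑ k, c k • x k)) :
    2 * U.card + Fintype.card ι ≤ Fintype.card V := by
  set e : V → V → ℝ := fun i => ⇑(hA.eigenvectorBasis i) with he
  have hAe : ∀ i, A *ᵥ e i = hA.eigenvalues i • e i := fun i => hA.mulVec_eigenvectorBasis i
  have hAs : ∀ y : V → ℝ, A *ᵥ (s * y) = -(s * (A *ᵥ y)) := by
    intro y
    ext v
    simp only [mulVec, dotProduct, Pi.mul_apply, Pi.neg_apply, Finset.mul_sum,
      ← Finset.sum_neg_distrib]
    refine Finset.sum_congr rfl fun w _ => ?_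
    rw [← mul_assoc, hsA v w]
    ring
  have hee : ∀ i j, e i ⬝ᵥ e j = if i = j then 1 else 0 := by
    intro i j
    have h := (orthonormal_iff_ite.mp hA.eigenvectorBasis.orthonormal) j i
    rw [EuclideanSpace.inner_eq_star_dotProduct] at h
    simpa [he, eq_comm] using h
  have hsym : ∀ y z : V → ℝ, (A *ᵥ y) ⬝ᵥ z = y ⬝ᵥ (A *ᵥ z) := by
    intro y z
    have hT : Aᵀ = A := by
      have := hA
      rwa [Matrix.IsHermitian, Matrix.conjTranspose_eq_transpose_of_trivial] at this
    rw [dotProduct_mulVec, ← mulVec_transpose, hT]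
  have hss : ∀ y z : V → ℝ, (s * y) ⬝ᵥ (s * z) = y ⬝ᵥ z := by
    intro y z
    refine Finset.sum_congr rfl fun v _ => ?_
    simp only [Pi.mul_apply]
    linear_combination (y v * z v) * hs v
  -- `s * e j` is an eigenvector for the negative of the `j`-th eigenvalue. Eigenvectors of a
  -- symmetric matrix for different eigenvalues are orthogonal; `hUU` covers `i = j` as well.
  have hes : ∀ i ∈ U, ∀ j ∈ U, e i ⬝ᵥ (s * e j) = 0 := by
    intro i hi j hj
    have h1 := hsym (e i) (s * e j)
    rw [hAs, hAe, hAe, smul_dotProduct, mul_smul_comm, dotProduct_neg, dotProduct_smul,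
      smul_eq_mul, smul_eq_mul] at h1
    refine (mul_eq_zero.mp ?_).resolve_left (hUU i hi j hj)
    linarith
  have hli : LinearIndependent ℝ
      (Sum.elim (Sum.elim (fun i : U => e i) (fun i : U => s * e i)) x) := by
    rw [Fintype.linearIndependent_iff]
    intro g hg
    rw [Fintype.sum_sum_type, Fintype.sum_sum_type] at hg
    simp only [Sum.elim_inl, Sum.elim_inr] at hg
    set a : U → ℝ := fun i => g (Sum.inl (Sum.inl i)) with ha
    set b : U → ℝ := fun i => g (Sum.inl (Sum.inr i)) with hb
    set c : ι → ℝ := fun k => g (Sum.inr k) with hc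
    set y : V → ℝ := ∑ i, a i • e i with hy
    set z : V → ℝ := ∑ i, b i • (s * e i) with hz
    have hxy : ∑ k, c k • x k = -(y + z) := by
      rw [eq_neg_iff_add_eq_zero, add_comm]
      exact hg
    have gen : ∀ p q : U → ℝ, (∑ i, p i • e i + ∑ i, q i • (s * e i)) ⬝ᵥ
        (∑ i, p i • e i + ∑ i, q i • (s * e i)) = ∑ i, (p i ^ 2 + q i ^ 2) := by
      intro p q
      have h1 : ∀ p q : U → ℝ, (∑ i, p i • e i) ⬝ᵥ (∑ i, q i • e i) = ∑ i, p i * q i := by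
        intro p q
        simp [sum_dotProduct, dotProduct_sum, hee, mul_comm]
      have h2 : (∑ i, p i • e i) ⬝ᵥ (∑ i, q i • (s * e i)) = 0 := by
        simp only [sum_dotProduct, dotProduct_sum, smul_dotProduct, dotProduct_smul]
        refine Finset.sum_eq_zero fun i _ => ?_
        rw [Finset.sum_eq_zero, smul_zero]
        intro j _
        rw [hes _ j.2 _ i.2, smul_zero]
      have h3 : ∑ i, q i • (s * e i) = s * ∑ i, q i • e i := by
        simp [Finset.mul_sum]
      rw [add_dotProduct, dotProduct_add, dotProduct_add, h2,
        dotProduct_comm (∑ i, q i • (s * e i)) (∑ i, p i • e i), h2, h1, h3, hss, h1, Finset.sum_add_distrib]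
      simp [sq]
    have hAyz : A *ᵥ (y + z) = ∑ i, (a i * hA.eigenvalues i) • e i +
        ∑ i, (-(b i * hA.eigenvalues i)) • (s * e i) := by
      rw [mulVec_add, hy, hz, mulVec_sum, mulVec_sum]
      congr 1
      · refine Finset.sum_congr rfl fun i _ => ?_
        rw [mulVec_smul, hAe, smul_smul]
      · refine Finset.sum_congr rfl fun i _ => ?_
        rw [mulVec_smul, hAs, hAe, mul_smul_comm, smul_neg, smul_smul, neg_smul]
    -- The linear relation identifies the combination of the `x k` with `-(y + z)`. In the
    -- orthonormal system of the `e i` and `s * e i` the inequality says that the sum of `(λ_i ^ 2 -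
    -- 1) * (a i ^ 2 + b i ^ 2)` is at most zero, which forces all `a i` and `b i` to vanish.
    have hle := hAx c
    rw [hxy, mulVec_neg, neg_dotProduct_neg, neg_dotProduct_neg, hAyz, gen, hy, hz, gen,
      ← sub_nonneg, ← Finset.sum_sub_distrib] at hle
    have hterm : ∀ i : U, a i ^ 2 + b i ^ 2 - ((a i * hA.eigenvalues i) ^ 2 +
        (-(b i * hA.eigenvalues i)) ^ 2) =
        -((hA.eigenvalues i ^ 2 - 1) * (a i ^ 2 + b i ^ 2)) := fun i => by ring
    simp only [hterm, Finset.sum_neg_distrib] at hle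
    have hpos : ∀ i ∈ (Finset.univ : Finset U),
        0 ≤ (hA.eigenvalues i ^ 2 - 1) * (a i ^ 2 + b i ^ 2) := fun i _ =>
      mul_nonneg (by linarith [hU _ i.2]) (by positivity)
    have hz0 := (Finset.sum_eq_zero_iff_of_nonneg hpos).mp
      (le_antisymm (by linarith) (Finset.sum_nonneg hpos))
    have hab : ∀ i : U, a i = 0 ∧ b i = 0 := by
      intro i
      have h := (mul_eq_zero.mp (hz0 i (Finset.mem_univ i))).resolve_left
        (by linarith [hU _ i.2])
      constructor <;> nlinarith [sq_nonneg (a i), sq_nonneg (b i)]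
    have hc0 : ∀ k, c k = 0 := by
      refine Fintype.linearIndependent_iff.mp hx c ?_
      rw [hxy, hy, hz]
      simp [hab]
    rintro ((i | i) | k)
    · exact (hab i).1
    · exact (hab i).2
    · exact hc0 k
  have := hli.fintype_card_le_finrank
  simp only [Fintype.card_sum, Fintype.card_coe, Module.finrank_fintype_fun_eq_card] at this
  omega

/-! ### Balls and separated sets in subcubic graphs -/

/-- The vertices that can be reached from `v` by a walk of length at most `r`. -/
def walkBall {V : Type*} (G : SimpleGraph V) (r : ℕ) (v : V) : Set V :=
  {w | ∃ p : G.Walk v w, p.length ≤ r}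

section walkBall

variable {V : Type*} {G : SimpleGraph V}

theorem self_mem_walkBall (r : ℕ) (v : V) : v ∈ walkBall G r v :=
  ⟨.nil, Nat.zero_le r⟩

theorem walkBall_mono {r s : ℕ} (h : r ≤ s) (v : V) : walkBall G r v ⊆ walkBall G s v :=
  fun _ ⟨p, hp⟩ => ⟨p, hp.trans h⟩

theorem mem_walkBall_symm {r : ℕ} {v w : V} (h : w ∈ walkBall G r v) : v ∈ walkBall G r w :=
  let ⟨p, hp⟩ := h
  ⟨p.reverse, by simpa using hp⟩

theorem mem_walkBall_trans {r s : ℕ} {u v w : V} (h : v ∈ walkBall G r u)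
    (h' : w ∈ walkBall G s v) : w ∈ walkBall G (r + s) u :=
  let ⟨p, hp⟩ := h
  let ⟨q, hq⟩ := h'
  ⟨p.append q, by rw [SimpleGraph.Walk.length_append]; omega⟩

theorem mem_walkBall_of_adj {r : ℕ} {v w w' : V} (h : w ∈ walkBall G r v) (h' : G.Adj w w') :
    w' ∈ walkBall G (r + 1) v :=
  mem_walkBall_trans h ⟨h'.toWalk, by simp⟩

/-- A ball is its centre together with at most three balls of smaller radius, and `1 + 3 * 4 ^ r ≤ 4
^ (r + 1)`. The bound is crude; any bound depending only on `r` would give some `δ`. -/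
theorem card_walkBall_le [Fintype V] [DecidableEq V] [DecidableRel G.Adj]
    (hG : G.maxDegree ≤ 3) (r : ℕ) (v : V) :
    (walkBall G r v).ncard ≤ 4 ^ r := by
  induction r generalizing v with
  | zero =>
    have : walkBall G 0 v ⊆ {v} := by
      rintro w ⟨p, hp⟩
      exact (SimpleGraph.Walk.eq_of_length_eq_zero (Nat.le_zero.mp hp)).symm
    simpa using Set.ncard_le_ncard this
  | succ r ih =>
    have hsub : walkBall G (r + 1) v ⊆
        {v} ∪ ⋃ u ∈ G.neighborFinset v, walkBall G r u := by
      rintro w ⟨p, hp⟩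
      cases p with
      | nil => exact Or.inl rfl
      | cons h q =>
        refine Or.inr (Set.mem_biUnion (by simpa using h) ⟨q, ?_⟩)
        simpa using hp
    have hU : (⋃ u ∈ G.neighborFinset v, walkBall G r u).ncard ≤ 3 * 4 ^ r := by
      refine (Finset.set_ncard_biUnion_le _ _).trans ?_
      refine (Finset.sum_le_card_nsmul _ _ _ fun u _ => ih u).trans ?_
      rw [smul_eq_mul]
      exact Nat.mul_le_mul_right _ ((G.degree_le_maxDegree v).trans hG)
    calc (walkBall G (r + 1) v).ncard
        ≤ ({v} ∪ ⋃ u ∈ G.neighborFinset v, walkBall G r u).ncard :=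
          Set.ncard_le_ncard hsub (Set.toFinite _)
      _ ≤ 1 + 3 * 4 ^ r := (Set.ncard_union_le _ _).trans (by simpa using hU)
      _ ≤ 4 ^ (r + 1) := by
        have := Nat.one_le_pow r 4 (by norm_num)
        rw [pow_succ]
        omega

/-- A maximal set of pairwise far vertices in a subcubic graph has linear size. -/
theorem exists_separated_finset [Fintype V] [DecidableEq V] [DecidableRel G.Adj]
    (hG : G.maxDegree ≤ 3) (r : ℕ) :
    ∃ F : Finset V, (∀ u ∈ F, ∀ v ∈ F, v ∈ walkBall G r u → u = v) ∧
      Fintype.card V ≤ F.card * 4 ^ r := by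
  classical
  obtain ⟨F, hF⟩ := (Set.toFinite {F : Finset V | ∀ u ∈ F, ∀ v ∈ F,
    v ∈ walkBall G r u → u = v}).exists_maximal ⟨∅, by simp⟩
  refine ⟨F, hF.prop, ?_⟩
  -- A vertex outside all the balls could be added to `F`, against maximality.
  have hcover : (Set.univ : Set V) ⊆ ⋃ u ∈ F, walkBall G r u := by
    intro v _
    by_contra hv
    simp only [Set.mem_iUnion, not_exists] at hv
    have hins : insert v F ∈ {F : Finset V | ∀ u ∈ F, ∀ v ∈ F, v ∈ walkBall G r u → u = v} := by
      intro a ha b hb hab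
      rcases Finset.mem_insert.mp ha with rfl | ha' <;>
        rcases Finset.mem_insert.mp hb with rfl | hb'
      · rfl
      · exact (hv b hb' (mem_walkBall_symm hab)).elim
      · exact (hv a ha' hab).elim
      · exact hF.prop a ha' b hb' hab
    have := hF.le_of_ge hins (Finset.subset_insert v F)
    exact hv v (this (Finset.mem_insert_self v F)) (self_mem_walkBall r v)
  calc Fintype.card V = (Set.univ : Set V).ncard := by
        rw [Set.ncard_univ, Nat.card_eq_fintype_card]
    _ ≤ (⋃ u ∈ F, walkBall G r u).ncard := Set.ncard_le_ncard hcover (Set.toFinite _)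
    _ ≤ ∑ u ∈ F, (walkBall G r u).ncard := Finset.set_ncard_biUnion_le _ _
    _ ≤ F.card * 4 ^ r := by
      refine (Finset.sum_le_card_nsmul _ _ _ fun u _ => card_walkBall_le hG r u).trans ?_
      rw [smul_eq_mul]

end walkBall

/-! ### From local vectors that are not expanded to the middle eigenvalues -/

/-- The adjacency operator of `G` strictly increases the norm of every nonzero integer vector
supported in `B`. -/
def ExpandsOn {V : Type*} [Fintype V] (G : SimpleGraph V) [DecidableRel G.Adj] (B : Set V) :
    Prop :=
  ∀ x : V → ℤ, (∀ v ∉ B, x v = 0) → x ≠ 0 →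
    ∑ v, x v ^ 2 < ∑ v, (∑ w ∈ G.neighborFinset v, x w) ^ 2

theorem ExpandsOn.mono {V : Type*} [Fintype V] {G : SimpleGraph V} [DecidableRel G.Adj]
    {B C : Set V} (h : ExpandsOn G C) (hBC : B ⊆ C) : ExpandsOn G B :=
  fun x hx => h x fun v hv => hx v fun hB => hv (hBC hB)

open Matrix in
/-- Vectors that live on far apart balls and are not expanded by the adjacency matrix of a
bipartite graph bound the number of eigenvalues on one side of `[-1, 1]`. -/
theorem two_mul_card_add_card_le_of_separated {V : Type*} [Fintype V] [DecidableEq V]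
    {G : SimpleGraph V} [DecidableRel G.Adj] (hb : G.IsBipartite) {R : ℕ}
    (h : ∀ v, ¬ ExpandsOn G (walkBall G R v)) (F : Finset V)
    (hF : ∀ u ∈ F, ∀ v ∈ F, v ∈ walkBall G (2 * R + 2) u → u = v) (U : Finset V)
    (hU : ∀ i ∈ U, 1 < (isHermitian_adjMatrix_real G).eigenvalues i ^ 2)
    (hUU : ∀ i ∈ U, ∀ j ∈ U, (isHermitian_adjMatrix_real G).eigenvalues i +
      (isHermitian_adjMatrix_real G).eigenvalues j ≠ 0) :
    2 * U.card + F.card ≤ Fintype.card V := by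
  obtain ⟨col⟩ := hb
  have hex : ∀ u : V, ∃ x : V → ℤ, (∀ v ∉ walkBall G R u, x v = 0) ∧ x ≠ 0 ∧
      ∑ v, (∑ w ∈ G.neighborFinset v, x w) ^ 2 ≤ ∑ v, x v ^ 2 := by
    intro u
    have hu := h u
    unfold ExpandsOn at hu
    push Not at hu
    exact hu
  choose X hX0 hXne hXle using hex
  set x : F → V → ℝ := fun u v => (X u v : ℝ) with hx
  set A := G.adjMatrix ℝ with hA
  have hAx : ∀ u v, (A *ᵥ x u) v = ((∑ w ∈ G.neighborFinset v, X u w : ℤ) : ℝ) := by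
    intro u v
    rw [hA, SimpleGraph.adjMatrix_mulVec_apply]
    push_cast
    rfl
  have hsupp : ∀ u : F, ∀ v, x u v ≠ 0 → v ∈ walkBall G (R + 1) (u : V) := by
    intro u v hv
    by_contra hn
    refine hv ?_
    simp only [hx]
    rw [hX0 _ _ fun hm => hn (walkBall_mono (Nat.le_succ R) _ hm), Int.cast_zero]
  have hAsupp : ∀ u : F, ∀ v, (A *ᵥ x u) v ≠ 0 → v ∈ walkBall G (R + 1) (u : V) := by
    intro u v hv
    by_contra hn
    refine hv ?_
    rw [hAx, Finset.sum_eq_zero, Int.cast_zero]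
    intro w hw
    rw [SimpleGraph.mem_neighborFinset] at hw
    exact hX0 _ _ fun hm => hn (mem_walkBall_of_adj hm hw.symm)
  -- This is used for `x` and for its image under `A`. Both families are supported in balls of
  -- radius `R + 1`, which are disjoint for centres further apart than `2 * R + 2`, so squared norms
  -- of combinations have no cross terms.
  have horth : ∀ y : F → V → ℝ, (∀ u : F, ∀ v, y u v ≠ 0 → v ∈ walkBall G (R + 1) (u : V)) →
      ∀ c : F → ℝ, (∑ u, c u • y u) ⬝ᵥ (∑ u, c u • y u) =
        ∑ u, c u ^ 2 * (y u ⬝ᵥ y u) := by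
    intro y hy c
    have h0 : ∀ u w : F, u ≠ w → y u ⬝ᵥ y w = 0 := by
      intro u w huw
      refine Finset.sum_eq_zero fun v _ => ?_
      by_contra hne
      obtain ⟨h1, h2⟩ := mul_ne_zero_iff.mp hne
      refine huw (Subtype.ext (hF u u.2 w w.2 ?_))
      have := mem_walkBall_trans (hy u v h1) (mem_walkBall_symm (hy w v h2))
      exact walkBall_mono (by omega) _ this
    simp only [sum_dotProduct, dotProduct_sum, smul_dotProduct, dotProduct_smul, smul_eq_mul]
    refine Finset.sum_congr rfl fun u _ => ?_
    rw [Finset.sum_eq_single u]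
    · ring
    · intro w _ hw
      rw [h0 w u hw, mul_zero]
    · simp
  have hxx : ∀ u : F, 0 < x u ⬝ᵥ x u := by
    intro u
    obtain ⟨v, hv⟩ := Function.ne_iff.mp (hXne u)
    refine Finset.sum_pos' (fun i _ => mul_self_nonneg _) ⟨v, Finset.mem_univ v, ?_⟩
    exact mul_self_pos.mpr (by simpa [hx] using hv)
  have hle : ∀ u : F, (A *ᵥ x u) ⬝ᵥ (A *ᵥ x u) ≤ x u ⬝ᵥ x u := by
    intro u
    have := hXle u
    have h2 : ((∑ v, (∑ w ∈ G.neighborFinset v, X u w) ^ 2 : ℤ) : ℝ) ≤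
      ((∑ v, X u v ^ 2 : ℤ) : ℝ) := by exact_mod_cast this
    rw [Int.cast_sum, Int.cast_sum] at h2
    simp only [dotProduct, hAx, ← sq]
    simpa [hx] using h2
  have hli : LinearIndependent ℝ x := by
    rw [Fintype.linearIndependent_iff]
    intro c hc u
    have h1 := horth x hsupp c
    rw [hc, dotProduct_zero, eq_comm, Finset.sum_eq_zero_iff_of_nonneg
      fun u _ => mul_nonneg (sq_nonneg _) (hxx u).le] at h1
    simpa [(hxx u).ne'] using h1 u (Finset.mem_univ u)
  have key := two_mul_card_add_card_le (isHermitian_adjMatrix_real G)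
    (fun v => if col v = 0 then 1 else -1) (fun v => by split_ifs <;> norm_num) ?_ U hU hUU x hli ?_
  · simpa using key
  · intro v w
    rw [SimpleGraph.adjMatrix_apply]
    split_ifs with hvw hw hv hv <;> norm_num
    · exact col.valid hvw (hv.trans hw.symm)
    · have := col.valid hvw
      omega
  · intro c
    have hsum : A *ᵥ ∑ u, c u • x u = ∑ u, c u • (A *ᵥ x u) := by
      rw [mulVec_sum]
      exact Finset.sum_congr rfl fun u _ => mulVec_smul _ _ _
    rw [hsum, horth _ hAsupp, horth _ hsupp]
    exact Finset.sum_le_sum fun u _ => mul_le_mul_of_nonneg_left (hle u) (sq_nonneg _)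

/-- If the adjacency operator is nowhere locally expanding at scale `R`, the eigenvalues with
index close to the middle are in `[-1, 1]`. -/
theorem adjEigenvalue_mem_Icc {V : Type*} [Fintype V] [DecidableEq V]
    {G : SimpleGraph V} [DecidableRel G.Adj] (hb : G.IsBipartite) (hd : G.maxDegree ≤ 3) {R : ℕ}
    (h : ∀ v, ¬ ExpandsOn G (walkBall G R v)) (i : Fin (Fintype.card V))
    (h₁ : (1 / 2 - 1 / 4 ^ (2 * R + 4)) * (Fintype.card V : ℝ) ≤ ((i : ℕ) : ℝ) + 1)
    (h₂ : ((i : ℕ) : ℝ) + 1 ≤ (1 / 2 + 1 / 4 ^ (2 * R + 4)) * (Fintype.card V : ℝ)) :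
    adjEigenvalue G i ∈ Set.Icc (-1 : ℝ) 1 := by
  obtain ⟨F, hF, hcard⟩ := exists_separated_finset hd (2 * R + 2)
  have hn0 : 0 < (Fintype.card V : ℝ) := by exact_mod_cast i.pos
  -- With `δ = 1 / 4 ^ (2 * R + 4)` and `n ≤ #F * 4 ^ (2 * R + 2)` one gets `4 * δ * n ≤ #F / 4`.
  -- The contradictions below only need `2 * δ * n < #F`.
  have hF' : 4 * (1 / 4 ^ (2 * R + 4) * (Fintype.card V : ℝ)) < F.card := by
    have h4 : (Fintype.card V : ℝ) ≤ F.card * 4 ^ (2 * R + 2) := by exact_mod_cast hcard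
    have h5 : (0 : ℝ) < 4 ^ (2 * R + 2) := by positivity
    have h6 : (4 : ℝ) ^ (2 * R + 4) = 16 * 4 ^ (2 * R + 2) := by ring
    have h7 : 4 * (1 / 4 ^ (2 * R + 4) * (Fintype.card V : ℝ)) = Fintype.card V / (4 * 4 ^ (2 * R + 2)) := by
      rw [h6]
      field_simp
      norm_num
    rw [h7, div_lt_iff₀ (by positivity)]
    nlinarith
  set eqv : Fin (Fintype.card V) ≃ V := Fintype.equivOfCardEq (Fintype.card_fin _) with heqv
  have heig : ∀ j : Fin (Fintype.card V), (isHermitian_adjMatrix_real G).eigenvalues (eqv j) =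
      adjEigenvalue G j := by
    intro j
    simp only [Matrix.IsHermitian.eigenvalues, adjEigenvalue, heqv]
    rw [Equiv.symm_apply_apply]
  have hanti : Antitone (adjEigenvalue G) :=
    (isHermitian_adjMatrix_real G).eigenvalues₀_antitone
  have bound : ∀ S : Finset (Fin (Fintype.card V)), (∀ j ∈ S, 1 < adjEigenvalue G j ^ 2) →
      (∀ j ∈ S, ∀ k ∈ S, adjEigenvalue G j + adjEigenvalue G k ≠ 0) →
      2 * S.card + F.card ≤ Fintype.card V := by
    intro S hS hSS
    have := two_mul_card_add_card_le_of_separated hb h F hF (S.map eqv.toEmbedding)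
      (by
        intro v hv
        obtain ⟨j, hj, rfl⟩ := Finset.mem_map.mp hv
        simpa only [Equiv.coe_toEmbedding, heig] using hS j hj) (by
        intro v hv w hw
        obtain ⟨j, hj, rfl⟩ := Finset.mem_map.mp hv
        obtain ⟨k, hk, rfl⟩ := Finset.mem_map.mp hw
        simpa only [Equiv.coe_toEmbedding, heig] using hSS j hj k hk)
    simpa using this
  refine ⟨?_, ?_⟩
  · by_contra! hlt
    -- Indices are 0-based: `n - i` eigenvalues have index at least `i`, and in the other case `i +
    -- 1` have index at most `i`.
    have hall : ∀ j ∈ Finset.Ici i, adjEigenvalue G j < -1 := fun j hj =>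
      (hanti (Finset.mem_Ici.mp hj)).trans_lt hlt
    have := bound (Finset.Ici i) (fun j hj => by nlinarith [hall j hj])
      (fun j hj k hk => by linarith [hall j hj, hall k hk])
    rw [Fin.card_Ici] at this
    have h3 : (Fintype.card V : ℝ) + F.card ≤ 2 * (i : ℕ) := by
      have := i.isLt
      exact_mod_cast (by omega : Fintype.card V + F.card ≤ 2 * (i : ℕ))
    linarith
  · by_contra! hlt
    have hall : ∀ j ∈ Finset.Iic i, 1 < adjEigenvalue G j := fun j hj =>
      hlt.trans_le (hanti (Finset.mem_Iic.mp hj))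
    have := bound (Finset.Iic i) (fun j hj => by nlinarith [hall j hj])
      (fun j hj k hk => by linarith [hall j hj, hall k hk])
    rw [Fin.card_Iic] at this
    have h3 : 2 * (((i : ℕ) : ℝ) + 1) + F.card ≤ Fintype.card V := by exact_mod_cast this
    linarith

/-! ### List operations for evaluation in the kernel -/

theorem Nat.beq_eq_false_iff {a b : ℕ} : Nat.beq a b = false ↔ a ≠ b := by
  rw [← Bool.not_eq_true, Nat.beq_eq]

/-- `List.foldr` as a recursor application, which evaluates fast in the kernel. -/
noncomputable def foldList {α β : Type} (f : α → β → β) (b : β) (l : List α) : β :=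
  List.rec (motive := fun _ => β) b (fun a _ ih => f a ih) l

theorem foldList_nil {α β : Type} (f : α → β → β) (b : β) : foldList f b [] = b := rfl

theorem foldList_cons {α β : Type} (f : α → β → β) (b : β) (a : α) (l : List α) :
    foldList f b (a :: l) = f a (foldList f b l) := rfl

/-- All elements of the list satisfy `p`. -/
noncomputable def allList {α : Type} (l : List α) (p : α → Bool) : Bool :=
  foldList (fun a r => bif p a then r else false) true l

theorem allList_iff {α : Type} {l : List α} {p : α → Bool} :
    allList l p = true ↔ ∀ a ∈ l, p a = true := by
  induction l with
  | nil => simp [allList, foldList_nil]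
  | cons a l ih =>
    rw [allList, foldList_cons, ← allList, List.forall_mem_cons, ← ih]
    cases p a <;> simp

/-- Membership in a list of natural numbers. -/
noncomputable def memList (i : ℕ) (l : List ℕ) : Bool :=
  foldList (fun a r => bif Nat.beq i a then true else r) false l

theorem memList_iff {i : ℕ} {l : List ℕ} : memList i l = true ↔ i ∈ l := by
  induction l with
  | nil => simp [memList, foldList_nil]
  | cons a l ih =>
    rw [memList, foldList_cons, ← memList, List.mem_cons, ← ih, ← Nat.beq_eq]
    cases Nat.beq i a <;> simp

/-- The list has no repetitions. -/
noncomputable def nodupList (l : List ℕ) : Bool :=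
  List.rec (motive := fun _ => Bool) true (fun a l ih => !memList a l && ih) l

theorem nodupList_iff {l : List ℕ} : nodupList l = true ↔ l.Nodup := by
  induction l with
  | nil => simp [nodupList]
  | cons a l ih =>
    rw [List.nodup_cons, ← memList_iff, ← ih]
    simp [nodupList]

/-- The sum of `c` over the list. -/
noncomputable def sumList (c : ℕ → ℤ) (l : List ℕ) : ℤ :=
  foldList (fun i r => c i + r) 0 l

theorem sumList_eq {c : ℕ → ℤ} {l : List ℕ} : sumList c l = (l.map c).sum := by
  induction l with
  | nil => rfl
  | cons a l ih => rw [sumList, foldList_cons, ← sumList, ih, List.map_cons, List.sum_cons]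

/-- The value that the association list `z` gives to the key `a`, with default value `d`. -/
noncomputable def assocGet {α : Type} (d : α) (z : List (ℕ × α)) (a : ℕ) : α :=
  foldList (fun p r => bif Nat.beq p.1 a then p.2 else r) d z

theorem assocGet_cons_self {α : Type} (d : α) (z : List (ℕ × α)) (p : ℕ × α) :
    assocGet d (p :: z) p.1 = p.2 := by
  rw [assocGet, foldList_cons, Nat.beq_eq.mpr rfl, cond_true]

theorem assocGet_cons_of_ne {α : Type} (d : α) (z : List (ℕ × α)) {p : ℕ × α} {a : ℕ}
    (h : p.1 ≠ a) : assocGet d (p :: z) a = assocGet d z a := by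
  rw [assocGet, foldList_cons, Nat.beq_eq_false_iff.mpr h, cond_false, ← assocGet]

theorem assocGet_mem {α : Type} {d : α} {z : List (ℕ × α)} {a : ℕ} (h : assocGet d z a ≠ d) :
    (a, assocGet d z a) ∈ z := by
  induction z with
  | nil => exact (h rfl).elim
  | cons p z ih =>
    by_cases hp : p.1 = a
    · subst hp
      rw [assocGet_cons_self]
      exact List.mem_cons_self
    · rw [assocGet_cons_of_ne d z hp] at h ⊢
      exact List.mem_cons_of_mem _ (ih h)

theorem assocGet_zip_mem {d : ℕ} {l m : List ℕ} (h : l.length = m.length) {a : ℕ} (ha : a ∈ l) :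
    (a, assocGet d (l.zip m) a) ∈ l.zip m := by
  induction l generalizing m with
  | nil => simp at ha
  | cons b l ih =>
    cases m with
    | nil => simp at h
    | cons c m =>
      rw [List.zip_cons_cons]
      by_cases hb : b = a
      · subst hb
        rw [assocGet_cons_self d _ (b, c)]
        exact List.mem_cons_self
      · rw [assocGet_cons_of_ne d _ hb]
        exact List.mem_cons_of_mem _ (ih (by simpa using h)
          ((List.mem_cons.mp ha).resolve_left fun h => hb h.symm))

/-- Prepend `l` to the list attached to the key `u`. -/
noncomputable def addNbr (u l : ℕ) (z : List (ℕ × List ℕ)) : List (ℕ × List ℕ) :=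
  foldList (fun p r => (p.1, bif Nat.beq p.1 u then l :: p.2 else p.2) :: r) [] z

theorem addNbr_cons (u l : ℕ) (p : ℕ × List ℕ) (z : List (ℕ × List ℕ)) :
    addNbr u l (p :: z) = (p.1, bif Nat.beq p.1 u then l :: p.2 else p.2) :: addNbr u l z := rfl

theorem map_fst_addNbr (u l : ℕ) (z : List (ℕ × List ℕ)) :
    (addNbr u l z).map Prod.fst = z.map Prod.fst := by
  induction z with
  | nil => rfl
  | cons p z ih => rw [addNbr_cons, List.map_cons, List.map_cons, ih]

theorem mem_assocGet_addNbr {u l i j : ℕ} {z : List (ℕ × List ℕ)} (hu : u ∈ z.map Prod.fst) :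
    j ∈ assocGet [] (addNbr u l z) i ↔ j ∈ assocGet [] z i ∨ i = u ∧ j = l := by
  induction z with
  | nil => simp at hu
  | cons p z ih =>
    rw [addNbr_cons]
    by_cases hp : p.1 = i
    · subst hp
      rw [assocGet_cons_self, assocGet_cons_self [] _ (p.1, _)]
      by_cases hpu : p.1 = u
      · rw [Nat.beq_eq.mpr hpu, cond_true, List.mem_cons]
        tauto
      · rw [Nat.beq_eq_false_iff.mpr hpu, cond_false]
        tauto
    · rw [assocGet_cons_of_ne _ _ hp, assocGet_cons_of_ne _ _ (by exact hp)]
      by_cases hu' : u ∈ z.map Prod.fst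
      · exact ih hu'
      -- Here only the head row has the key `u`, and it is not the row looked up; the tail is left
      -- unchanged.
      · have hpu : u = p.1 := by
          rw [List.map_cons, List.mem_cons] at hu
          tauto
        have hiu : i ≠ u := fun h => hp (by rw [h, hpu])
        have hz : addNbr u l z = z := by
          clear ih hu
          induction z with
          | nil => rfl
          | cons q z ih =>
            rw [List.map_cons, List.mem_cons, not_or] at hu'
            rw [addNbr_cons, ih hu'.2, Nat.beq_eq_false_iff.mpr (Ne.symm hu'.1), cond_false]
        rw [hz]
        tauto

/-! ### Patterns, their occurrences, and branching on a further neighbour -/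

/-- A finite piece of a bipartite graph. Vertices are labelled by natural numbers whose parity is
the colour; all neighbours of the labels in `full` are recorded. -/
structure Pattern where
  /-- the labels of the vertices, with their recorded neighbours -/
  rows : List (ℕ × List ℕ)
  /-- labels of vertices that have no other neighbours -/
  full : List ℕ

namespace Pattern

/-- The labels of the vertices. -/
noncomputable def verts (T : Pattern) : List ℕ := foldList (fun p r => p.1 :: r) [] T.rows

theorem verts_eq (T : Pattern) : T.verts = T.rows.map Prod.fst := by
  rw [verts]
  induction T.rows with
  | nil => rfl
  | cons p z ih => rw [foldList_cons, ih, List.map_cons]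

/-- The recorded neighbours of a label. -/
noncomputable def nbrs (T : Pattern) (i : ℕ) : List ℕ := assocGet [] T.rows i

/-- In a subcubic graph, all neighbours of the label `i` are recorded. -/
noncomputable def isFull (T : Pattern) (i : ℕ) : Bool :=
  memList i T.full || match T.nbrs i with
    | [a, b, c] => !Nat.beq a b && !Nat.beq a c && !Nat.beq b c
    | _ => false

/-- Record that `u` has no further neighbours. -/
def close (T : Pattern) (u : ℕ) : Pattern := ⟨T.rows, u :: T.full⟩

/-- Join the labels `u` and `l`. -/
noncomputable def link (T : Pattern) (u l : ℕ) : Pattern :=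
  ⟨addNbr l u (addNbr u l T.rows), T.full⟩

/-- Join the label `u` to a new label `n`. -/
noncomputable def grow (T : Pattern) (u n : ℕ) : Pattern :=
  ⟨(n, [u]) :: addNbr u n T.rows, T.full⟩

theorem verts_link (T : Pattern) (u l : ℕ) : (T.link u l).verts = T.verts := by
  simp only [verts_eq, link, map_fst_addNbr]

theorem verts_grow (T : Pattern) (u n : ℕ) : (T.grow u n).verts = n :: T.verts := by
  simp only [verts_eq, grow, List.map_cons, map_fst_addNbr]

theorem mem_verts_of_mem_nbrs {T : Pattern} {i j : ℕ} (h : j ∈ T.nbrs i) : i ∈ T.verts := by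
  rw [verts_eq]
  have hne : assocGet [] T.rows i ≠ [] := List.ne_nil_of_mem h
  exact List.mem_map_of_mem (f := Prod.fst) (assocGet_mem hne)

theorem mem_nbrs_link {T : Pattern} {u l i j : ℕ} (hu : u ∈ T.verts) (hl : l ∈ T.verts) :
    j ∈ (T.link u l).nbrs i ↔ j ∈ T.nbrs i ∨ i = u ∧ j = l ∨ i = l ∧ j = u := by
  rw [verts_eq] at hu hl
  rw [nbrs, link, mem_assocGet_addNbr (by rwa [map_fst_addNbr]), mem_assocGet_addNbr hu, or_assoc]
  rfl

/-- Freshness of `n` matters: the new row is put in front of the association list and would hide an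
older row with the same key. -/
theorem mem_nbrs_grow {T : Pattern} {u n i j : ℕ} (hu : u ∈ T.verts) (hn : n ∉ T.verts) :
    j ∈ (T.grow u n).nbrs i ↔ j ∈ T.nbrs i ∨ i = u ∧ j = n ∨ i = n ∧ j = u := by
  by_cases hi : n = i
  · subst hi
    have h1 : n ≠ u := fun h => hn (h ▸ hu)
    have h2 : j ∉ T.nbrs n := fun h => hn (mem_verts_of_mem_nbrs h)
    rw [nbrs, grow, assocGet_cons_self [] _ (n, [u])]
    simp [h1, h2]
  · rw [nbrs, grow, assocGet_cons_of_ne _ _ (by exact hi),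
      mem_assocGet_addNbr (by rwa [← verts_eq])]
    have : ¬ i = n := fun h => hi h.symm
    simp [this, nbrs]

/-- The labels that may be joined to `u`. -/
noncomputable def candidates (T : Pattern) (u : ℕ) : List ℕ :=
  foldList (fun l r => bif Nat.beq (l % 2) (u % 2) || memList l (T.nbrs u) || T.isFull l
    then r else l :: r) [] T.verts

/-- Completeness of the branching: an unrecorded edge from `u` to a labelled vertex goes to the
other colour class and cannot end at a full label, so the filters lose nothing. -/
theorem mem_candidates {T : Pattern} {u l : ℕ} (hl : l ∈ T.verts) (hlu : l % 2 ≠ u % 2)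
    (hn : l ∉ T.nbrs u) (hf : T.isFull l = false) : l ∈ T.candidates u := by
  have key : ∀ vs : List ℕ, l ∈ vs → l ∈ foldList (fun l r => bif Nat.beq (l % 2) (u % 2) ||
      memList l (T.nbrs u) || T.isFull l then r else l :: r) [] vs := by
    intro vs hl
    induction vs with
    | nil => simp at hl
    | cons a v ih =>
      rw [foldList_cons]
      rcases List.mem_cons.mp hl with rfl | hl
      · have hn' : memList l (T.nbrs u) = false := by
          rw [← Bool.not_eq_true, memList_iff]
          exact hn
        rw [Nat.beq_eq_false_iff.mpr hlu, hf, hn']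
        exact List.mem_cons_self
      · cases Nat.beq (a % 2) (u % 2) || memList a (T.nbrs u) || T.isFull a
        · exact List.mem_cons_of_mem _ (ih hl)
        · exact ih hl
  exact key _ hl

/-- `ρ` is an occurrence of the pattern `T` within the set `B` of vertices of the graph `G` with the
proper colouring `col`. -/
structure Realizes {V : Type*} (G : SimpleGraph V) (col : V → Bool) (B : Set V) (T : Pattern)
    (ρ : ℕ → V) : Prop where
  nodup : T.verts.Nodup
  symm : ∀ i j, j ∈ T.nbrs i → i ∈ T.nbrs j
  full_mem : ∀ i ∈ T.full, i ∈ T.verts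
  inj : ∀ i ∈ T.verts, ∀ j ∈ T.verts, ρ i = ρ j → i = j
  mem : ∀ i ∈ T.verts, ρ i ∈ B
  adj : ∀ i j, j ∈ T.nbrs i → G.Adj (ρ i) (ρ j)
  side : ∀ i ∈ T.verts, ∀ j ∈ T.verts, (col (ρ i) = col (ρ j) ↔ i % 2 = j % 2)
  full : ∀ i ∈ T.full, ∀ w, G.Adj (ρ i) w → ∃ j ∈ T.nbrs i, w = ρ j

section Realizes

variable {V : Type*} {G : SimpleGraph V} {col : V → Bool} {B : Set V} {T : Pattern} {ρ : ℕ → V}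

theorem Realizes.adj_of_mem_nbrs (h : Realizes G col B T ρ) {i j : ℕ} (hij : j ∈ T.nbrs i) :
    G.Adj (ρ i) (ρ j) :=
  h.adj i j hij

theorem Realizes.mem_verts_of_mem_nbrs (h : Realizes G col B T ρ) {i j : ℕ}
    (hij : j ∈ T.nbrs i) : j ∈ T.verts :=
  Pattern.mem_verts_of_mem_nbrs (h.symm i j hij)

/-- Either the label was declared full, or it has three distinct recorded neighbours, and an
unrecorded one would be a fourth neighbour in a graph of maximum degree at most three. -/
theorem Realizes.exists_of_isFull [Fintype V] [DecidableRel G.Adj]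
    (hd : G.maxDegree ≤ 3) (h : Realizes G col B T ρ) {i : ℕ} (hi : T.isFull i = true) {w : V}
    (hw : G.Adj (ρ i) w) : ∃ j ∈ T.nbrs i, w = ρ j := by
  classical
  rw [isFull, Bool.or_eq_true] at hi
  rcases hi with hi | hi
  · exact h.full i (memList_iff.mp hi) w hw
  · split at hi
    · rename_i a b c habc
      simp only [Bool.and_eq_true, Bool.not_eq_true', ← Bool.not_eq_true, Nat.beq_eq] at hi
      have hm : ∀ j ∈ [a, b, c], j ∈ T.nbrs i := fun j hj => habc ▸ hj
      have hv : ∀ j ∈ [a, b, c], j ∈ T.verts := fun j hj => h.mem_verts_of_mem_nbrs (hm j hj)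
      have hne : ∀ j ∈ [a, b, c], ∀ k ∈ [a, b, c], j ≠ k → ρ j ≠ ρ k :=
        fun j hj k hk hjk he => hjk (h.inj j (hv j hj) k (hv k hk) he)
      by_contra! hcon
      have hsub : ({w, ρ a, ρ b, ρ c} : Finset V) ⊆ G.neighborFinset (ρ i) := by
        intro x hx
        simp only [Finset.mem_insert, Finset.mem_singleton] at hx
        rw [SimpleGraph.mem_neighborFinset]
        rcases hx with rfl | rfl | rfl | rfl
        · exact hw
        · exact h.adj_of_mem_nbrs (hm a (by simp))
        · exact h.adj_of_mem_nbrs (hm b (by simp))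
        · exact h.adj_of_mem_nbrs (hm c (by simp))
      have hcard : ({w, ρ a, ρ b, ρ c} : Finset V).card = 4 := by
        rw [Finset.card_insert_of_notMem, Finset.card_insert_of_notMem,
          Finset.card_insert_of_notMem, Finset.card_singleton]
        · simpa using hne b (by simp) c (by simp) hi.2
        · simpa using ⟨hne a (by simp) b (by simp) hi.1.1, hne a (by simp) c (by simp) hi.1.2⟩
        · simpa using ⟨hcon a (hm a (by simp)), hcon b (hm b (by simp)), hcon c (hm c (by simp))⟩
      have := Finset.card_le_card hsub
      rw [hcard, SimpleGraph.card_neighborFinset_eq_degree] at this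
      have := (G.degree_le_maxDegree (ρ i)).trans hd
      omega
    · simp at hi

theorem Realizes.mono {C : Set V} (h : Realizes G col B T ρ) (hBC : B ⊆ C) :
    Realizes G col C T ρ :=
  { h with mem := fun i hi => hBC (h.mem i hi) }

end Realizes

/-- `T` occurs in no ball of `G` such that the adjacency operator is expanding on the concentric
ball whose radius is larger by `d`. -/
def Refuted {V : Type*} [Fintype V] (G : SimpleGraph V) [DecidableRel G.Adj] (col : V → Bool)
    (T : Pattern) (d : ℕ) : Prop :=
  ∀ v r, ExpandsOn G (walkBall G (r + d) v) → ∀ ρ, ¬ Realizes G col (walkBall G r v) T ρ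

section Refuted

variable {V : Type*} [Fintype V] {G : SimpleGraph V} [DecidableRel G.Adj] {col : V → Bool}
  {T : Pattern} {d : ℕ}

theorem Refuted.mono {d' : ℕ} (h : Refuted G col T d) (hd : d ≤ d') : Refuted G col T d' :=
  fun v r hE ρ => h v r (hE.mono (walkBall_mono (by omega) v)) ρ

/-- A pattern is refuted if all possibilities for a further neighbour of a label `u` are. -/
theorem refuted_of_children (hd : G.maxDegree ≤ 3) (hcol : ∀ v w, G.Adj v w → col v ≠ col w)
    {u n : ℕ} (hu : u ∈ T.verts) (hn : n ∉ T.verts) (hun : n % 2 ≠ u % 2)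
    (hclose : Refuted G col (T.close u) d)
    (hlink : ∀ l ∈ T.candidates u, Refuted G col (T.link u l) d)
    (hgrow : Refuted G col (T.grow u n) d) : Refuted G col T (d + 1) := by
  intro v r hE ρ hρ
  -- Closing `u` or adding an edge keeps all vertices in the ball of radius `r`, so the extra unit
  -- of radius is needed only when a new vertex is added.
  have hE' : ExpandsOn G (walkBall G (r + d) v) := hE.mono (walkBall_mono (by omega) v)
  by_cases hall : ∀ w, G.Adj (ρ u) w → ∃ j ∈ T.nbrs u, w = ρ j
  · refine hclose v r hE' ρ { hρ with full_mem := ?_, full := ?_ }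
    · intro i hi
      rcases List.mem_cons.mp hi with rfl | hi
      · exact hu
      · exact hρ.full_mem i hi
    · intro i hi w hw
      rcases List.mem_cons.mp hi with rfl | hi
      · exact hall w hw
      · exact hρ.full i hi w hw
  push Not at hall
  obtain ⟨w, huw, hw⟩ := hall
  by_cases hex : ∃ l ∈ T.verts, w = ρ l
  · obtain ⟨l, hl, rfl⟩ := hex
    have hlu : l ∉ T.nbrs u := fun h => hw l h rfl
    have hnb := fun i j => mem_nbrs_link (T := T) (i := i) (j := j) hu hl
    refine hlink l (mem_candidates hl ?_ hlu ?_) v r hE' ρ ⟨?_, ?_, ?_, ?_, ?_, ?_, ?_, ?_⟩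
    · exact fun h => hcol _ _ huw ((hρ.side l hl u hu).mpr h).symm
    -- If `l` were full, `ρ u` would be the image of a recorded neighbour of `l`; by injectivity and
    -- symmetry the edge would already be recorded.
    · rw [← Bool.not_eq_true]
      intro hf
      obtain ⟨j, hj, huj⟩ := hρ.exists_of_isFull hd hf huw.symm
      rw [← hρ.inj u hu j (hρ.mem_verts_of_mem_nbrs hj) huj] at hj
      exact hlu (hρ.symm _ _ hj)
    · rw [verts_link]
      exact hρ.nodup
    · intro i j hij
      rw [hnb] at hij ⊢
      have := hρ.symm i j
      tauto
    · rw [verts_link]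
      exact hρ.full_mem
    · rw [verts_link]
      exact hρ.inj
    · rw [verts_link]
      exact hρ.mem
    · intro i j hij
      rcases (hnb i j).mp hij with hij | ⟨rfl, rfl⟩ | ⟨rfl, rfl⟩
      · exact hρ.adj i j hij
      · exact huw
      · exact huw.symm
    · rw [verts_link]
      exact hρ.side
    · intro i hi x hx
      obtain ⟨j, hj, rfl⟩ := hρ.full i hi x hx
      exact ⟨j, (hnb i j).mpr (Or.inl hj), rfl⟩
  · push Not at hex
    have hne : ∀ i ∈ T.verts, i ≠ n := fun i hi h => hn (h ▸ hi)
    have hup : ∀ i ∈ T.verts, Function.update ρ n w i = ρ i := fun i hi =>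
      Function.update_of_ne (hne i hi) w ρ
    have hself : Function.update ρ n w n = w := Function.update_self n w ρ
    -- With only two colours, differing from the colour of `ρ u` determines the colour of `w`;
    -- likewise for the parities of `n` and `u`.
    have hcolw : ∀ i ∈ T.verts, (col (ρ i) = col w ↔ i % 2 = n % 2) := by
      intro i hi
      have h1 := hρ.side i hi u hu
      have h2 := hcol _ _ huw
      have h3 : col (ρ i) = col w ↔ ¬ col (ρ i) = col (ρ u) := by
        have : ∀ a b c : Bool, c ≠ b → (a = b ↔ ¬a = c) := by decide
        exact this _ _ _ h2
      rw [h3, h1]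
      omega
    -- The new vertex may lie at distance `r + 1`. The radius of expansion is unchanged, as `(r + 1)
    -- + d = r + (d + 1)`.
    refine hgrow v (r + 1) (hE.mono (walkBall_mono (by omega) v)) (Function.update ρ n w) ?_
    have hnb := fun i j => mem_nbrs_grow (T := T) (i := i) (j := j) hu hn
    refine ⟨?_, ?_, ?_, ?_, ?_, ?_, ?_, ?_⟩ <;> (try rw [verts_grow])
    · exact List.nodup_cons.mpr ⟨hn, hρ.nodup⟩
    · intro i j hij
      rw [hnb] at hij ⊢
      have := hρ.symm i j
      tauto
    · exact fun i hi => List.mem_cons_of_mem _ (hρ.full_mem i hi)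
    · intro i hi j hj
      rcases List.mem_cons.mp hi with rfl | hi' <;> rcases List.mem_cons.mp hj with rfl | hj'
      · simp
      · rw [hself, hup j hj']
        exact fun h => (hex j hj' h).elim
      · rw [hself, hup i hi']
        exact fun h => (hex i hi' h.symm).elim
      · rw [hup i hi', hup j hj']
        exact hρ.inj i hi' j hj'
    · intro i hi
      rcases List.mem_cons.mp hi with rfl | hi
      · rw [hself]
        exact mem_walkBall_of_adj (hρ.mem u hu) huw
      · rw [hup i hi]
        exact walkBall_mono (Nat.le_succ r) v (hρ.mem i hi)
    · intro i j hij
      rcases (hnb i j).mp hij with hij | ⟨rfl, rfl⟩ | ⟨rfl, rfl⟩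
      · rw [hup i (mem_verts_of_mem_nbrs hij), hup j (hρ.mem_verts_of_mem_nbrs hij)]
        exact hρ.adj i j hij
      · rw [hself, hup i hu]
        exact huw
      · rw [hself, hup j hu]
        exact huw.symm
    · intro i hi j hj
      rcases List.mem_cons.mp hi with rfl | hi' <;> rcases List.mem_cons.mp hj with rfl | hj'
      · simp
      · rw [hself, hup j hj', eq_comm, hcolw j hj', eq_comm]
      · rw [hself, hup i hi', hcolw i hi']
      · rw [hup i hi', hup j hj']
        exact hρ.side i hi' j hj'
    · intro i hi x hx
      rw [hup i (hρ.full_mem i hi)] at hx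
      obtain ⟨j, hj, rfl⟩ := hρ.full i hi x hx
      exact ⟨j, (hnb i j).mpr (Or.inl hj), (hup j (hρ.mem_verts_of_mem_nbrs hj)).symm⟩

end Refuted

/-! ### Verification of embeddings and of witness vectors -/

/-- The vertices are listed once, the neighbour relation is symmetric, and full labels belong to
vertices. -/
noncomputable def wellFormed (T : Pattern) : Bool :=
  nodupList T.verts &&
  (allList T.rows fun p => allList p.2 fun j => memList p.1 (T.nbrs j)) &&
  allList T.full fun i => memList i T.verts

/-- The list `f` of images of the vertices of `P` is an embedding of `P` into `S`. -/
noncomputable def checkEmbed (P S : Pattern) (f : List ℕ) : Bool :=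
  Nat.beq P.verts.length f.length && nodupList f && (allList f fun i => memList i S.verts) &&
  (match P.verts.zip f with
    | [] => true
    | p :: z => allList z fun q => Nat.beq ((q.1 + q.2) % 2) ((p.1 + p.2) % 2)) &&
  (allList P.rows fun p => allList p.2 fun j =>
    memList (assocGet 0 (P.verts.zip f) j) (S.nbrs (assocGet 0 (P.verts.zip f) p.1))) &&
  allList P.full fun i => S.isFull (assocGet 0 (P.verts.zip f) i) &&
    allList (S.nbrs (assocGet 0 (P.verts.zip f) i)) fun j =>
      memList j ((P.nbrs i).map (assocGet 0 (P.verts.zip f)))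

theorem eq_of_mem_zip {l m : List ℕ} (hm : m.Nodup) {a b c : ℕ} (ha : (a, c) ∈ l.zip m)
    (hb : (b, c) ∈ l.zip m) : a = b := by
  obtain ⟨i, hi, h1⟩ := List.mem_iff_getElem.mp ha
  obtain ⟨j, hj, h2⟩ := List.mem_iff_getElem.mp hb
  rw [List.getElem_zip, Prod.mk.injEq] at h1 h2
  rw [List.length_zip] at hi hj
  have : i = j := (hm.getElem_inj_iff (hi := by omega) (hj := by omega)).mp (h1.2.trans h2.2.symm)
  subst this
  exact h1.1.symm.trans h2.1

section soundness

variable {V : Type*} [Fintype V] {G : SimpleGraph V} [DecidableRel G.Adj] {col : V → Bool}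
  {P S : Pattern} {d : ℕ}

/-- Occurrences compose with embeddings. The parity of a label plus its image need only be constant,
so an embedding may exchange the two colours. A full label must go to a full label of `S`, all of
whose neighbours there are images of recorded neighbours; otherwise fullness would not transfer. -/
theorem Realizes.of_checkEmbed (hd : G.maxDegree ≤ 3) {B : Set V} {ρ : ℕ → V} {f : List ℕ}
    (hP : P.wellFormed = true) (hf : checkEmbed P S f = true) (h : Realizes G col B S ρ) :
    Realizes G col B P (fun i => ρ (assocGet 0 (P.verts.zip f) i)) := by
  simp only [wellFormed, Bool.and_eq_true, allList_iff, memList_iff, nodupList_iff] at hP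
  obtain ⟨⟨hPn, hPe⟩, hPf⟩ := hP
  simp only [checkEmbed, Bool.and_eq_true, allList_iff, memList_iff, nodupList_iff,
    Nat.beq_eq] at hf
  obtain ⟨⟨⟨⟨⟨hlen, hnd⟩, hfS⟩, hpar⟩, hedge⟩, hfull⟩ := hf
  set g := assocGet 0 (P.verts.zip f) with hg
  have hrow : ∀ i j, j ∈ P.nbrs i → (i, P.nbrs i) ∈ P.rows := fun i j hij =>
    assocGet_mem (List.ne_nil_of_mem hij)
  have hgz : ∀ i ∈ P.verts, (i, g i) ∈ P.verts.zip f := fun i hi => assocGet_zip_mem hlen hi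
  have hgS : ∀ i ∈ P.verts, g i ∈ S.verts := fun i hi => hfS _ (List.of_mem_zip (hgz i hi)).2
  have hginj : ∀ i ∈ P.verts, ∀ j ∈ P.verts, g i = g j → i = j := by
    intro i hi j hj hij
    have hj' := hgz j hj
    rw [← hij] at hj'
    exact eq_of_mem_zip hnd (hgz i hi) hj'
  have hparity : ∃ c, ∀ i ∈ P.verts, (i + g i) % 2 = c := by
    revert hpar
    generalize hz : P.verts.zip f = z at hgz
    cases z with
    | nil => exact fun _ => ⟨0, fun i hi => by simpa using hgz i hi⟩
    | cons p z =>
      intro hpar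
      refine ⟨(p.1 + p.2) % 2, fun i hi => ?_⟩
      rcases List.mem_cons.mp (hgz i hi) with h | h
      · rw [← h]
      · simp only [allList_iff, Nat.beq_eq] at hpar
        exact hpar _ h
  obtain ⟨c, hc⟩ := hparity
  refine ⟨hPn, fun i j hij => hPe _ (hrow i j hij) j hij, hPf, ?_, fun i hi => h.mem _ (hgS i hi), ?_, ?_, ?_⟩
  · exact fun i hi j hj hij => hginj i hi j hj (h.inj _ (hgS i hi) _ (hgS j hj) hij)
  · exact fun i j hij => h.adj_of_mem_nbrs (hedge _ (hrow i j hij) j hij)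
  · intro i hi j hj
    rw [h.side _ (hgS i hi) _ (hgS j hj)]
    have h1 := hc i hi
    have h2 := hc j hj
    omega
  · intro i hi w hw
    obtain ⟨h1, h2⟩ := hfull i hi
    obtain ⟨j, hj, rfl⟩ := h.exists_of_isFull hd h1 hw
    obtain ⟨k, hk, rfl⟩ := List.mem_map.mp (h2 j hj)
    exact ⟨k, hk, rfl⟩

/-- The combination `x` of fully known vertices is a nonzero vector that is not expanded. -/
noncomputable def checkWitness (S : Pattern) (x : List (ℕ × ℤ)) : Bool :=
  (allList x fun p => memList p.1 S.verts && S.isFull p.1) &&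
  (allList S.verts fun l => nodupList (S.nbrs l)) &&
  decide (0 < sumList (fun i => assocGet 0 x i * assocGet 0 x i) S.verts) &&
  decide (sumList (fun l => sumList (assocGet 0 x) (S.nbrs l) * sumList (assocGet 0 x) (S.nbrs l))
    S.verts ≤ sumList (fun i => assocGet 0 x i * assocGet 0 x i) S.verts)

/-- The vector is supported on full labels, so every neighbour of its support is recorded. Its image
therefore vanishes outside the pattern, and both squared norms are finite integer sums over labels.
At a label that is not full the sum over recorded neighbours is still right: an unrecorded neighbour
carries the value zero. -/
theorem Realizes.not_expandsOn (hd : G.maxDegree ≤ 3) {B : Set V} {ρ : ℕ → V}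
    {x : List (ℕ × ℤ)} (hx : checkWitness S x = true) (h : Realizes G col B S ρ) :
    ¬ ExpandsOn G B := by
  classical
  simp only [checkWitness, Bool.and_eq_true, allList_iff, memList_iff, nodupList_iff,
    decide_eq_true_eq, sumList_eq, ← sq] at hx
  obtain ⟨⟨⟨hxv, hnd⟩, hpos⟩, hle⟩ := hx
  set c := assocGet 0 x with hc
  -- Labels not listed in `x` get the default coefficient `0`, so a nonzero coefficient comes from
  -- an entry that was checked to be full.
  have hfull : ∀ i, c i ≠ 0 → i ∈ S.verts ∧ S.isFull i = true := fun i hi =>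
    hxv _ (assocGet_mem hi)
  set X : V → ℤ := fun v => ∑ i ∈ S.verts.toFinset, if ρ i = v then c i else 0 with hX
  have hinj : Set.InjOn ρ S.verts.toFinset := by
    intro i hi j hj hij
    simp only [List.coe_toFinset, Set.mem_ofPred_eq] at hi hj
    exact h.inj i hi j hj hij
  have hXρ : ∀ i ∈ S.verts, X (ρ i) = c i := by
    intro i hi
    simp only [hX]
    rw [Finset.sum_eq_single i]
    · simp
    · intro j hj hji
      rw [if_neg fun he => hji (h.inj j (List.mem_toFinset.mp hj) i hi he)]
    · exact fun hn => (hn (List.mem_toFinset.mpr hi)).elim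
  have hX0 : ∀ v, X v ≠ 0 → ∃ i ∈ S.verts, v = ρ i ∧ c i ≠ 0 := by
    intro v hv
    obtain ⟨i, hi, hne⟩ := Finset.exists_ne_zero_of_sum_ne_zero hv
    rw [ne_eq, ite_eq_right_iff, Classical.not_imp] at hne
    exact ⟨i, List.mem_toFinset.mp hi, hne.1.symm, hne.2⟩
  have hsumX : ∑ v, X v ^ 2 = (S.verts.map fun i => c i ^ 2).sum := by
    rw [← List.sum_toFinset _ h.nodup, ← Finset.sum_subset (Finset.subset_univ
      (S.verts.toFinset.image ρ)), Finset.sum_image hinj]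
    · exact Finset.sum_congr rfl fun i hi => by rw [hXρ i (List.mem_toFinset.mp hi)]
    · intro v _ hv
      by_contra hne
      obtain ⟨i, hi, rfl, -⟩ := hX0 v fun h0 => hne (by rw [h0]; rfl)
      exact hv (Finset.mem_image_of_mem ρ (List.mem_toFinset.mpr hi))
  have hAρ : ∀ l ∈ S.verts, ∑ w ∈ G.neighborFinset (ρ l), X w = ((S.nbrs l).map c).sum := by
    intro l hl
    have hsub : (S.nbrs l).toFinset.image ρ ⊆ G.neighborFinset (ρ l) := by
      intro w hw
      obtain ⟨i, hi, rfl⟩ := Finset.mem_image.mp hw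
      rw [SimpleGraph.mem_neighborFinset]
      exact h.adj_of_mem_nbrs (List.mem_toFinset.mp hi)
    have hv : ∀ i ∈ (S.nbrs l).toFinset, i ∈ S.verts := fun i hi =>
      h.mem_verts_of_mem_nbrs (List.mem_toFinset.mp hi)
    rw [← List.sum_toFinset _ (hnd l hl), ← Finset.sum_subset hsub, Finset.sum_image]
    · exact Finset.sum_congr rfl fun i hi => hXρ i (hv i hi)
    · exact fun i hi j hj hij => h.inj i (hv i hi) j (hv j hj) hij
    · intro w hw hw'
      by_contra hne
      obtain ⟨i, hi, rfl, hci⟩ := hX0 w hne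
      rw [SimpleGraph.mem_neighborFinset] at hw
      obtain ⟨j, hj, hlj⟩ := h.exists_of_isFull hd (hfull i hci).2 hw.symm
      rw [← h.inj l hl j (h.mem_verts_of_mem_nbrs hj) hlj] at hj
      exact hw' (Finset.mem_image_of_mem ρ (List.mem_toFinset.mpr (h.symm _ _ hj)))
  have hsumA : ∑ v, (∑ w ∈ G.neighborFinset v, X w) ^ 2 =
      (S.verts.map fun l => ((S.nbrs l).map c).sum ^ 2).sum := by
    rw [← List.sum_toFinset _ h.nodup, ← Finset.sum_subset (Finset.subset_univ
      (S.verts.toFinset.image ρ)), Finset.sum_image hinj]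
    · exact Finset.sum_congr rfl fun i hi => by rw [hAρ i (List.mem_toFinset.mp hi)]
    · intro v _ hv
      rw [Finset.sum_eq_zero, zero_pow two_ne_zero]
      intro w hw
      by_contra hne
      obtain ⟨i, hi, rfl, hci⟩ := hX0 w hne
      rw [SimpleGraph.mem_neighborFinset] at hw
      obtain ⟨j, hj, rfl⟩ := h.exists_of_isFull hd (hfull i hci).2 hw.symm
      exact hv (Finset.mem_image_of_mem ρ
        (List.mem_toFinset.mpr (h.mem_verts_of_mem_nbrs hj)))
  intro hE
  refine absurd (hE X ?_ ?_) ?_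
  · intro v hv
    by_contra hne
    obtain ⟨i, hi, rfl, -⟩ := hX0 v hne
    exact hv (h.mem i hi)
  · rintro h0
    rw [← hsumX, h0] at hpos
    simp at hpos
  · rw [hsumX, hsumA, not_lt]
    exact hle

end soundness

/-! ### Certificates and their soundness -/

/-- A reason why a pattern does not occur: a vector that is not expanded, or an embedding of an
earlier pattern of the list (counted from its end). -/
inductive Refutation where
  | witness (x : List (ℕ × ℤ))
  | embed (j : ℕ) (f : List ℕ)

/-- The refutation is valid for `S`, given the refuted patterns `L`. -/
noncomputable def Refutation.check (L : List Pattern) (S : Pattern) : Refutation → Bool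
  | witness x => checkWitness S x
  | embed j f => match L[j]? with
    | some P => checkEmbed P S f
    | none => false

/-- A pattern, a label `pivot` and the fresh label `fresh`, with the reasons why `pivot` must have a
further neighbour, which cannot be new, nor equal to any candidate. -/
structure Step where
  pattern : Pattern
  pivot : ℕ
  fresh : ℕ
  closed : Refutation
  grown : Refutation
  linked : List Refutation

/-- The candidates `l` for joining to `u` are refuted. -/
noncomputable def checkLinks (L : List Pattern) (T : Pattern) (u : ℕ) : List ℕ → List Refutation → Bool
  | [], _ => true
  | _ :: _, [] => false
  | l :: ls, r :: rs => r.check L (T.link u l) && checkLinks L T u ls rs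

/-- The step refutes its pattern, given the refuted patterns `L`. -/
noncomputable def Step.check (L : List Pattern) (E : Step) : Bool :=
  E.pattern.wellFormed && memList E.pivot E.pattern.verts && !memList E.fresh E.pattern.verts &&
  !Nat.beq (E.fresh % 2) (E.pivot % 2) &&
  E.closed.check L (E.pattern.close E.pivot) &&
  E.grown.check L (E.pattern.grow E.pivot E.fresh) &&
  checkLinks L E.pattern E.pivot (E.pattern.candidates E.pivot) E.linked

/-- All steps are valid, given the refuted patterns `L`. -/
noncomputable def checkSteps : List Pattern → List Step → Bool
  | _, [] => true
  | L, E :: Es => E.check L && checkSteps (E.pattern :: L) Es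

section soundness

variable {V : Type*} [Fintype V] {G : SimpleGraph V} [DecidableRel G.Adj] {col : V → Bool}
  {S T : Pattern} {L : List Pattern} {d : ℕ}

/-- Neither reason costs radius: a witness is supported in the ball of the occurrence itself, and an
embedded pattern occurs in the same ball as `S`. -/
theorem refuted_of_check (hd : G.maxDegree ≤ 3)
    (hL : ∀ P ∈ L, P.wellFormed = true ∧ Refuted G col P d) {R : Refutation}
    (hR : R.check L S = true) : Refuted G col S d := by
  intro v r hE ρ hρ
  cases R with
  | witness x => exact hρ.not_expandsOn hd hR (hE.mono (walkBall_mono (Nat.le_add_right r d) v))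
  | embed j f =>
    rw [Refutation.check] at hR
    split at hR
    · rename_i P hP
      obtain ⟨h1, h2⟩ := hL P (List.mem_of_getElem? hP)
      exact h2 v r hE _ (hρ.of_checkEmbed hd h1 hR)
    · simp at hR

theorem refuted_of_checkLinks (hd : G.maxDegree ≤ 3)
    (hL : ∀ P ∈ L, P.wellFormed = true ∧ Refuted G col P d) {u : ℕ} {ls : List ℕ}
    {Rs : List Refutation} (hR : checkLinks L T u ls Rs = true) :
    ∀ l ∈ ls, Refuted G col (T.link u l) d := by
  induction ls generalizing Rs with
  | nil => simp
  | cons l ls ih =>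
    cases Rs with
    | nil => simp [checkLinks] at hR
    | cons R Rs =>
      rw [checkLinks, Bool.and_eq_true] at hR
      intro k hk
      rcases List.mem_cons.mp hk with rfl | hk
      · exact refuted_of_check hd hL hR.1
      · exact ih hR.2 k hk

/-- Each step adds at most one to the radius needed. Patterns refuted before are weakened to the new
radius, so that all of `L` shares one `d`, and the number of steps bounds the total. -/
theorem refuted_of_checkSteps (hd : G.maxDegree ≤ 3) (hcol : ∀ v w, G.Adj v w → col v ≠ col w)
    {Es : List Step} (hL : ∀ P ∈ L, P.wellFormed = true ∧ Refuted G col P d)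
    (hE : checkSteps L Es = true) : ∀ E ∈ Es, Refuted G col E.pattern (d + Es.length) := by
  induction Es generalizing L d with
  | nil => simp
  | cons E Es ih =>
    rw [checkSteps, Bool.and_eq_true] at hE
    obtain ⟨hE, hEs⟩ := hE
    simp only [Step.check, Bool.and_eq_true, memList_iff, Bool.not_eq_true', ← Bool.not_eq_true,
      Nat.beq_eq] at hE
    obtain ⟨⟨⟨⟨⟨⟨hwf, hu⟩, hn⟩, hun⟩, hc⟩, hg⟩, hl⟩ := hE
    have hT : Refuted G col E.pattern (d + 1) :=
      refuted_of_children hd hcol hu hn hun (refuted_of_check hd hL hc)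
        (refuted_of_checkLinks hd hL hl) (refuted_of_check hd hL hg)
    intro F hF
    rcases List.mem_cons.mp hF with rfl | hF
    · exact hT.mono (by simp)
    · have := ih (d := d + 1) (L := E.pattern :: L) ?_ hEs F hF
      · rwa [List.length_cons, add_comm Es.length 1, ← add_assoc]
      · intro P hP
        rcases List.mem_cons.mp hP with rfl | hP
        · exact ⟨hwf, hT⟩
        · exact ⟨(hL P hP).1, (hL P hP).2.mono (Nat.le_succ d)⟩

end soundness

end Pattern

/-! ### The Heawood pattern and the search data -/

namespace Pattern

/-- The Heawood graph as a pattern: the point `p` has the label `2 * p`, and the line `l` has the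
label `2 * l + 1`. -/
def heawood : Pattern :=
  ⟨[(0, [1, 9, 13]), (1, [0, 2, 6]), (2, [1, 3, 11]), (3, [2, 4, 8]), (4, [3, 5, 13]), (5, [4, 6,
    10]), (6, [1, 5, 7]), (7, [6, 8, 12]), (8, [3, 7, 9]), (9, [0, 8, 10]), (10, [5, 9, 11]), (11,
    [2, 10, 12]), (12, [7, 11, 13]), (13, [0, 4, 12])], []⟩

set_option maxRecDepth 10000 in
/-- Steps that refute larger and larger pieces of a subcubic graph, down to a single vertex. -/
def certificate : List Step :=
  -- The first group mainly treats vertices of degree two. It ends by excluding the path `2, 1, 0,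
  -- 3` with `0` full: a vertex of degree two, one of whose neighbours has a further neighbour.
  [⟨⟨[(0, [1, 3]), (1, [0, 2]), (3, [0, 2]), (2, [1, 3])], [0]⟩, 2, 5, .witness [(0, -2), (2, 1)],
     .witness [(0, -2), (2, 1)], []⟩,
   ⟨⟨[(1, [0, 2]), (0, [1, 3, 5]), (3, [0]), (2, [1, 5]), (5, [0, 2])], []⟩, 2, 7, .witness [(0,
     -1), (2, 1)], .witness [(0, -1), (2, 1)], [.witness [(0, -3), (2, 2)]]⟩,
   ⟨⟨[(0, [1, 3]), (1, [0, 2]), (3, [0, 4]), (2, [1, 5, 9]), (4, [3, 5, 7]), (5, [2, 4, 6]), (7,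
     [4]), (9, [2]), (6, [5, 11]), (11, [6])], [0]⟩, 6, 13, .witness [(0, 1), (4, -1), (6, 1)],
     .witness [(0, 2), (2, -1), (4, -1), (6, 1)], [.witness [(2, -1), (6, 1)], .witness [(4, -1),
     (6, 1)], .witness [(4, -1), (6, 1)], .witness [(2, -1), (6, 1)]]⟩,
   ⟨⟨[(0, [1, 3]), (1, [0, 2, 6]), (3, [0, 4]), (2, [1, 5, 7]), (4, [3, 5]), (5, [2, 4, 8]), (6,
     [1]), (7, [2]), (8, [5])], [3]⟩, 7, 10, .witness [(7, 1)], .embed 0 [3, 0, 4, 1, 5, 2, 8, 6,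
     7, 10], [.witness [(0, -1), (2, 1)], .witness [(2, -1), (4, 1)], .embed 1 [2, 1, 0, 7, 6],
     .embed 1 [5, 2, 1, 8, 7]]⟩,
   ⟨⟨[(0, [1, 3]), (1, [0, 2]), (3, [0, 4]), (2, [1, 5, 9]), (4, [3, 5, 7]), (5, [2, 4]), (7,
     [4]), (9, [2])], [0, 3]⟩, 5, 6, .witness [(3, -1), (5, 1)], .embed 0 [1, 2, 0, 5, 3, 4, 9, 6,
     7], []⟩,
   ⟨⟨[(0, [1, 3]), (1, [0, 2]), (3, [0, 4]), (2, [1, 5]), (4, [3, 5, 7]), (5, [2, 4]), (7, [4])],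
     [0, 3]⟩, 2, 9, .witness [(0, -1), (2, 1)], .embed 0 [0, 1, 3, 2, 4, 5, 7, 9], [.witness [(2,
     -1), (4, 1)]]⟩,
   ⟨⟨[(0, [1, 3]), (1, [0, 2, 6]), (3, [0, 4]), (2, [1]), (4, [3, 5]), (5, [4, 8]), (6, [1]), (8,
     [5])], [0, 3]⟩, 5, 10, .witness [(3, -1), (5, 1)], .witness [(1, 1), (3, -2), (5, 1)],
     [.embed 0 [3, 4, 0, 5, 1, 2, 6], .embed 0 [3, 4, 0, 5, 1, 6, 2]]⟩,
   ⟨⟨[(0, [1, 3]), (1, [0, 2]), (3, [0, 4]), (2, [1]), (4, [3, 5, 7]), (5, [4]), (7, [4])], [0,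
     3]⟩, 2, 9, .witness [(2, 1)], .embed 0 [3, 4, 0, 5, 1, 2, 7, 9], [.embed 1 [0, 1, 3, 2, 4, 5,
     7], .embed 1 [0, 1, 3, 2, 4, 7, 5]]⟩,
   ⟨⟨[(0, [1]), (1, [0, 4, 6]), (2, [3, 5]), (4, [1, 3]), (3, [2, 4]), (6, [1, 5, 7]), (5, [2,
     6]), (7, [6])], [3]⟩, 5, 8, .witness [(3, -1), (5, 1)], .embed 4 [4, 1, 3, 6, 2, 5, 0, 7, 8],
     [.witness [(1, -1), (5, 1)], .witness [(4, -1), (6, 1)]]⟩,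
   ⟨⟨[(0, [1, 3]), (1, [0, 2]), (3, [0, 4, 6]), (2, [1, 5]), (4, [3, 5]), (5, [2, 4]), (6, [3, 7,
     9]), (7, [6]), (9, [6])], [0, 5]⟩, 2, 11, .witness [(0, -1), (2, 1)], .witness [(0, -2), (2,
     1), (6, 1)], [.embed 0 [0, 3, 2, 4, 5, 6, 7, 9], .embed 0 [0, 3, 2, 4, 5, 6, 9, 7]]⟩,
   ⟨⟨[(0, [1, 3]), (1, [0, 2]), (3, [0, 4, 6]), (2, [1, 5]), (4, [3, 5, 7]), (5, [2, 4]), (7,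
     [4]), (6, [3, 9, 11]), (9, [6]), (11, [6])], [0]⟩, 5, 8, .embed 0 [0, 1, 3, 2, 4, 5, 6, 9,
     11], .embed 1 [7, 4, 1, 3, 0, 5, 2, 8], []⟩,
   ⟨⟨[(0, [1, 3]), (1, [0, 2]), (3, [0, 4, 6]), (2, [1, 13]), (4, [3, 5, 7]), (5, [4]), (7, [4]),
     (6, [3, 9, 11]), (9, [6]), (11, [6]), (13, [2])], [0]⟩, 2, 15, .witness [(0, -1), (2, 1)],
     .witness [(0, -2), (2, 1), (6, 1)], [.witness [(0, -2), (2, 1), (6, 1)], .witness [(0, -2),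
     (2, 1), (6, 1)], .witness [(0, -2), (2, 1), (4, 1)], .witness [(0, -2), (2, 1), (4, 1)]]⟩,
   ⟨⟨[(0, [1, 3]), (1, [0, 2]), (3, [0, 4, 6]), (2, [1]), (4, [3, 5, 7]), (5, [4]), (7, [4]), (6,
     [3, 9, 11]), (9, [6]), (11, [6])], [0]⟩, 2, 13, .witness [(2, 1)], .embed 0 [0, 1, 3, 2, 4,
     5, 7, 6, 9, 11, 13], [.embed 1 [0, 1, 3, 2, 4, 5, 7, 6, 9, 11], .embed 1 [0, 1, 3, 2, 4, 7,
     5, 6, 9, 11], .embed 1 [0, 1, 3, 2, 6, 9, 11, 4, 5, 7], .embed 1 [0, 1, 3, 2, 6, 11, 9, 4, 5,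
     7]]⟩,
   ⟨⟨[(0, [1, 3]), (1, [0, 2]), (3, [0, 4, 6]), (2, [1]), (4, [3, 5, 7]), (5, [4]), (7, [4]), (6,
     [3, 9]), (9, [6])], [0]⟩, 6, 11, .witness [(0, -1), (6, 1)], .embed 0 [0, 1, 3, 2, 4, 5, 7,
     6, 11, 9], [.witness [(0, -2), (6, 1)], .witness [(4, -1), (6, 1)], .witness [(4, -1), (6,
     1)]]⟩,
   ⟨⟨[(0, [1, 3]), (1, [0, 2]), (3, [0, 4, 6]), (2, [1]), (4, [3, 5, 7]), (5, [4]), (7, [4]), (6,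
     [3])], [0]⟩, 6, 9, .witness [(6, 1)], .embed 0 [0, 1, 3, 2, 4, 5, 7, 6, 9], [.witness [(1,
     -1), (3, 1)], .embed 12 [4, 3, 0, 5, 6], .embed 12 [4, 3, 0, 7, 6]]⟩,
   ⟨⟨[(0, [1, 3]), (1, [0, 2]), (3, [0, 4]), (2, [1]), (4, [3, 5, 7]), (5, [4]), (7, [4])], [0]⟩,
     3, 6, .embed 7 [0, 1, 3, 2, 4, 5, 7], .embed 0 [0, 1, 3, 2, 4, 5, 7, 6], [.embed 14 [0, 1, 3,
     2]]⟩,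
   ⟨⟨[(0, [1, 3]), (1, [0, 2]), (3, [0, 4]), (2, [1]), (4, [3, 5]), (5, [4])], [0]⟩, 4, 7,
     .witness [(0, -1), (4, 1)], .embed 0 [0, 1, 3, 2, 4, 7, 5], [.witness [(0, -2), (4, 1)]]⟩,
   ⟨⟨[(0, [1, 3]), (1, [0, 2]), (3, [0, 4]), (2, [1]), (4, [3])], [0]⟩, 2, 5, .witness [(2, 1)],
     .embed 0 [0, 3, 1, 4, 2, 5], [.embed 16 [0, 1, 3, 2]]⟩,
   ⟨⟨[(0, [1, 3]), (1, [0, 2]), (3, [0]), (2, [1])], [0]⟩, 3, 4, .witness [(3, 1)], .embed 0 [0,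
     1, 3, 2, 4], [.embed 17 [0, 1, 3, 2]]⟩,
   -- The 4-cycle.
   ⟨⟨[(0, [1, 3]), (1, [0, 2]), (2, [1, 3]), (3, [0, 2])], []⟩, 0, 5, .embed 18 [0, 1, 3, 2],
     .embed 17 [1, 0, 5, 2, 3], []⟩,
   -- From here on no pattern of a step has labels declared full. This group works mainly on
   -- configurations around hexagons, from dense ones to sparse ones.
   ⟨⟨[(0, [1, 3, 7]), (1, [0, 4]), (3, [0, 2]), (5, [8]), (2, [3, 9, 13]), (7, [0, 6, 10]), (9,
     [2, 6]), (11, [4, 6]), (13, [2, 4, 8]), (4, [1, 11, 13]), (6, [7, 9, 11]), (8, [5, 13]), (10,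
     [7, 15, 17]), (15, [10]), (17, [10])], []⟩, 8, 19, .witness [(2, -1), (4, -1), (6, 1), (8,
     2)], .witness [(0, -1), (2, 1), (4, 1), (6, -1), (8, -1), (10, 1)], [.witness [(4, -1), (8,
     1)], .witness [(2, -1), (8, 1)], .witness [(2, -1), (8, 1)], .witness [(4, -1), (8, 1)],
     .witness [(4, 1), (6, -1), (8, -1), (10, 1)], .witness [(4, 1), (6, -1), (8, -1), (10, 1)]]⟩,
   ⟨⟨[(0, [1, 3, 7]), (1, [0, 8]), (3, [0, 2, 6]), (2, [3]), (5, [4, 12]), (4, [5]), (6, [3, 9,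
     13]), (7, [0, 10, 14]), (9, [6, 10]), (11, [8, 10]), (13, [6, 8, 12]), (8, [1, 11, 13]), (10,
     [7, 9, 11]), (12, [5, 13]), (14, [7, 15]), (15, [14])], []⟩, 14, 17, .witness [(0, -1), (8,
     1), (10, -1), (14, 2)], .embed 0 [0, 1, 3, 5, 6, 7, 9, 11, 13, 8, 10, 12, 14, 17, 15],
     [.witness [(0, -1), (14, 1)], .witness [(3, -1), (5, -1), (7, 1), (13, 1)], .witness [(10,
     -1), (14, 1)], .witness [(10, -1), (14, 1)]]⟩,
   ⟨⟨[(0, [1, 3, 7]), (1, [0, 8]), (3, [0, 6]), (2, [5]), (5, [2, 12]), (4, [9]), (6, [3, 9, 13]),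
     (7, [0, 10, 14]), (9, [4, 6, 10]), (11, [8, 10]), (13, [6, 8, 12]), (8, [1, 11, 13]), (10,
     [7, 9, 11]), (12, [5, 13]), (14, [7])], []⟩, 14, 15, .witness [(14, 1)], .embed 0 [10, 11, 9,
     4, 5, 2, 6, 7, 3, 1, 13, 8, 0, 12, 14, 15], [.witness [(1, -1), (7, 1)], .witness [(3, -1),
     (7, 1)], .witness [(5, -1), (7, 1), (9, -1), (13, 1)], .witness [(7, -1), (11, 1)]]⟩,
   -- The Heawood graph with one edge removed. Joining `7` to `12` completes it, and the reference
   -- to `heawood`, the last entry of the list of refuted patterns, occurs only here.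
   ⟨⟨[(0, [1, 3, 7]), (1, [0, 4, 8]), (3, [0, 2, 6]), (2, [3, 5, 11]), (5, [2, 4, 12]), (4, [1, 5,
     9]), (6, [3, 9, 13]), (7, [0, 10]), (9, [4, 6, 10]), (11, [2, 8, 10]), (13, [6, 8, 12]), (8,
     [1, 11, 13]), (10, [7, 9, 11]), (12, [5, 13])], []⟩, 7, 14, .witness [(7, 2), (9, -1), (11,
     -1), (13, 1)], .embed 0 [0, 1, 3, 6, 13, 8, 2, 7, 11, 9, 5, 4, 10, 12, 14], [.embed 23 [0, 1,
     4, 5, 2, 11, 8, 13, 12, 7, 10, 9, 6, 3]]⟩,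
   ⟨⟨[(0, [1, 3, 7]), (1, [0, 4]), (3, [0, 2, 6]), (2, [3, 5, 11]), (5, [2, 4, 12]), (4, [1, 5,
     9]), (6, [3, 9, 13]), (7, [0, 10, 14]), (9, [4, 6, 10]), (11, [2, 10]), (13, [6, 8]), (8,
     [13]), (10, [7, 9, 11]), (12, [5]), (14, [7])], []⟩, 13, 16, .witness [(5, 1), (7, 1), (9,
     -2), (13, 2)], .witness [(3, -1), (5, 1), (7, 1), (9, -1), (13, 1)], [.embed 1 [0, 3, 1, 8,
     13, 6, 4, 7, 9, 11, 5, 2, 10, 12, 14], .embed 1 [2, 3, 11, 8, 13, 6, 10, 5, 9, 1, 7, 0, 4,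
     14, 12]]⟩,
   ⟨⟨[(0, [1, 3, 7]), (1, [0, 4, 8]), (3, [0, 2, 6]), (2, [3, 5, 11]), (5, [2, 4, 12]), (4, [1, 5,
     9]), (6, [3, 9, 13]), (7, [0, 10]), (9, [4, 6, 10]), (11, [2, 8, 10]), (13, [6, 8]), (8, [1,
     11, 13]), (10, [7, 9, 11]), (12, [5])], []⟩, 7, 14, .witness [(5, -1), (7, -2), (9, 1), (11,
     1)], .embed 0 [0, 1, 3, 2, 5, 4, 6, 7, 9, 11, 13, 8, 10, 12, 14], [.embed 1 [5, 2, 4, 1, 8,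
     11, 9, 12, 10, 0, 6, 3, 7, 13]]⟩,
   ⟨⟨[(0, [1, 3, 7]), (1, [0, 4, 8]), (3, [0, 2, 6]), (2, [3, 5, 11]), (5, [2, 4, 12]), (4, [1, 5,
     9]), (6, [3, 9]), (7, [0]), (9, [4, 6, 10]), (11, [2, 8, 10]), (13, [8]), (8, [1, 11, 13]),
     (10, [9, 11, 15]), (12, [5]), (15, [10])], []⟩, 12, 17, .witness [(12, 1)], .embed 1 [1, 8,
     4, 9, 10, 11, 5, 0, 2, 6, 12, 17, 3, 15, 7], [.embed 3 [9, 6, 4, 5, 12, 13, 1, 10, 8, 2, 0,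
     3, 11, 7, 15], .embed 1 [1, 8, 4, 9, 10, 11, 5, 0, 2, 6, 12, 13, 3, 15, 7], .embed 3 [3, 6,
     2, 5, 12, 13, 11, 0, 8, 4, 10, 9, 1, 15, 7]]⟩,
   ⟨⟨[(0, [1, 3, 7]), (1, [0, 4, 8]), (3, [0, 2, 6]), (2, [3, 5, 11]), (5, [2, 4, 12]), (4, [1, 5,
     9]), (6, [3, 9, 13]), (7, [0]), (9, [4, 6, 10]), (11, [2, 8, 10]), (13, [6, 8]), (8, [1, 11,
     13]), (10, [9, 11]), (12, [5])], []⟩, 13, 14, .witness [(5, 1), (9, -1), (11, -1), (13, 2)],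
     .embed 0 [5, 2, 4, 1, 0, 3, 9, 12, 6, 8, 10, 11, 13, 7, 14], [.witness [(8, -1), (10, 1)],
     .embed 1 [5, 2, 4, 1, 0, 3, 9, 12, 6, 8, 10, 11, 13, 7]]⟩,
   ⟨⟨[(0, [1, 3, 7]), (1, [0, 4, 8]), (3, [0, 2, 6]), (2, [3, 5, 11]), (5, [2, 4, 12]), (4, [1, 5,
     9]), (6, [3, 9, 13]), (7, [0]), (9, [4, 6, 10]), (11, [2, 8, 10]), (13, [6]), (8, [1, 11]),
     (10, [9, 11]), (12, [5])], []⟩, 8, 15, .witness [(2, -1), (4, -1), (6, 1), (8, 2)], .embed 1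
     [6, 3, 9, 4, 5, 2, 10, 13, 11, 1, 7, 0, 8, 12, 15], [.witness [(0, -1), (8, 1)], .embed 0 [0,
     1, 3, 2, 5, 4, 6, 7, 9, 11, 13, 8, 10, 12]]⟩,
   ⟨⟨[(1, [2]), (3, [0, 4]), (0, [3, 5, 11]), (5, [0, 2]), (2, [1, 5, 9]), (4, [3, 9]), (7, [6]),
     (9, [2, 4, 8]), (11, [0, 6]), (6, [7, 11, 13]), (8, [9, 13]), (13, [6, 8])], []⟩, 8, 15,
     .witness [(2, -1), (6, -1), (8, 2)], .witness [(0, 1), (2, -1), (6, -1), (8, 1)], [.witness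
     [(2, -1), (8, 1)], .witness [(3, -1), (9, 1)], .witness [(2, -1), (8, 1)], .witness [(6, -1),
     (8, 1)], .witness [(6, -1), (8, 1)]]⟩,
   ⟨⟨[(0, [1, 3, 5]), (1, [0, 4, 8]), (3, [0, 2, 6]), (2, [3, 9]), (4, [1, 7]), (6, [3, 7]), (5,
     [0, 10, 14]), (7, [4, 6, 12]), (9, [2, 8, 10]), (8, [1, 9]), (10, [5, 9, 11]), (12, [7]),
     (11, [10, 16]), (14, [5]), (16, [11])], []⟩, 11, 18, .witness [(3, 1), (5, -1), (9, -1), (11,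
     2)], .witness [(1, 1), (3, 1), (5, -1), (7, -1), (9, -1), (11, 1)], [.witness [(2, -1), (10,
     1)], .witness [(3, 1), (7, -1), (9, -1), (11, 1)], .witness [(1, 1), (7, -1), (9, -1), (11,
     1)], .witness [(8, -1), (10, 1)], .witness [(3, 1), (7, -1), (9, -1), (11, 1)], .witness [(5,
     -1), (11, 1)]]⟩,
   ⟨⟨[(0, [1, 3]), (1, [0, 4, 8]), (3, [0, 2, 6]), (2, [3, 5, 7]), (5, [2, 4, 12]), (4, [1, 5]),
     (6, [3, 9]), (7, [2, 8, 10]), (9, [6, 12, 14]), (8, [1, 7, 11]), (10, [7]), (12, [5, 9]),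
     (11, [8]), (14, [9])], []⟩, 11, 16, .witness [(11, 1)], .embed 0 [2, 3, 5, 4, 6, 12, 7, 9, 1,
     0, 8, 14, 11, 10, 16], [.witness [(0, -1), (8, 1)], .witness [(4, -1), (8, 1)], .embed 1 [0,
     2, 5, 4, 1, 7, 14, 8, 12, 9, 11, 6], .embed 11 [7, 8, 11, 10], .embed 1 [10, 0, 3, 2, 7, 1,
     14, 8, 6, 9, 11, 12], .embed 1 [10, 0, 3, 2, 7, 1, 12, 8, 6, 9, 11, 14]]⟩,
   ⟨⟨[(0, [1, 3, 7]), (1, [0, 4, 8]), (3, [0, 2, 6]), (2, [3, 5, 11]), (5, [2, 4]), (4, [1, 5,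
     9]), (6, [3, 9, 13]), (7, [0, 10]), (9, [4, 6, 12]), (11, [2, 8, 10]), (13, [6]), (8, [1,
     11]), (10, [7, 11]), (12, [9])], []⟩, 10, 15, .witness [(0, -1), (2, -1), (6, 1), (10, 2)],
     .embed 0 [1, 4, 0, 3, 2, 5, 7, 6, 10, 9, 13, 11, 12, 15], [.witness [(2, -1), (10, 1)],
     .embed 2 [12, 0, 1, 4, 9, 3, 2, 6, 8, 11, 13, 10]]⟩,
   ⟨⟨[(0, [1, 3, 7]), (1, [0, 4, 8]), (3, [0, 2, 6]), (2, [3, 5, 11]), (5, [2, 4]), (4, [1, 5,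
     9]), (6, [3, 9]), (7, [0, 14]), (9, [4, 6, 12]), (11, [2, 8, 10]), (8, [1, 11, 13]), (10,
     [11, 15]), (13, [8]), (12, [9]), (15, [10]), (14, [7])], []⟩, 7, 16, .witness [(3, -2), (7,
     2), (9, 1), (11, 1)], .witness [(1, -1), (3, -1), (7, 1), (9, 1), (11, 1)], [.witness [(0,
     -1), (6, 1)], .embed 1 [2, 11, 3, 0, 1, 8, 6, 7, 9, 10, 14, 4, 15, 12], .embed 0 [0, 3, 1, 4,
     5, 2, 8, 7, 11, 9, 13, 6, 12, 10]]⟩,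
   ⟨⟨[(0, [1, 3, 7]), (1, [0, 4, 8]), (3, [0, 2, 6]), (2, [3, 5, 11]), (5, [2, 4]), (4, [1, 5,
     9]), (6, [3, 9, 13]), (7, [0]), (9, [4, 6, 12]), (11, [2, 8, 10]), (13, [6]), (8, [1, 11,
     15]), (10, [11]), (15, [8]), (12, [9, 17]), (17, [12])], []⟩, 7, 14, .witness [(7, 1)],
     .embed 0 [0, 3, 1, 4, 5, 2, 8, 7, 11, 9, 6, 12, 13, 10, 17, 14], [.embed 1 [0, 1, 3, 2, 5, 4,
     6, 7, 9, 11, 13, 8, 10, 12], .embed 2 [3, 2, 0, 1, 4, 5, 7, 8, 12, 11, 15, 9, 10, 17]]⟩,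
   ⟨⟨[(0, [1, 3]), (1, [0, 4, 8]), (3, [0, 2, 6]), (2, [3, 5, 9]), (5, [2, 4, 12]), (4, [1, 5,
     7]), (6, [3, 7, 11]), (7, [4, 6, 14]), (9, [2, 8, 10]), (11, [6]), (8, [1, 9, 13]), (10,
     [9]), (12, [5]), (13, [8]), (14, [7])], []⟩, 11, 16, .witness [(11, 1)], .embed 0 [5, 2, 4,
     1, 0, 3, 7, 12, 6, 8, 14, 9, 13, 10, 11, 16], [.witness [(0, -1), (6, 1)], .embed 5 [14, 0,
     1, 4, 7, 3, 2, 6, 8, 9, 11, 10], .embed 2 [5, 4, 2, 3, 0, 1, 9, 12, 8, 6, 10, 7, 11, 13],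
     .embed 15 [6, 7, 14, 11]]⟩,
   ⟨⟨[(0, [1, 3, 7]), (1, [0, 4, 8]), (3, [0, 2, 6]), (2, [3, 5, 11]), (5, [2, 4, 12]), (4, [1, 5,
     9]), (6, [3, 9, 13]), (7, [0]), (9, [4, 6]), (11, [2, 8, 10]), (13, [6]), (8, [1, 11, 15]),
     (10, [11]), (12, [5]), (15, [8])], []⟩, 9, 14, .witness [(3, -1), (5, -1), (9, 2), (11, 1)],
     .embed 0 [0, 1, 3, 2, 5, 4, 6, 9, 11, 13, 8, 10, 12, 15, 14], [.embed 7 [0, 1, 3, 2, 5, 4, 6,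
     7, 9, 11, 13, 8, 10, 12], .witness [(5, -1), (9, 1)]]⟩,
   ⟨⟨[(0, [1, 3, 7]), (1, [0, 4, 8]), (3, [0, 2, 6]), (2, [3, 5, 11]), (5, [2, 4, 12]), (4, [1, 5,
     9]), (6, [3, 9, 13]), (7, [0]), (9, [4, 6]), (11, [2, 8, 10]), (13, [6]), (8, [1, 11]), (10,
     [11]), (12, [5])], []⟩, 9, 14, .witness [(3, -1), (5, -1), (9, 2), (11, 1)], .embed 0 [5, 4,
     2, 3, 0, 1, 11, 12, 8, 6, 10, 9, 13, 7, 14], [.witness [(4, -1), (8, 1)], .embed 8 [0, 1, 3,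
     2, 5, 4, 6, 7, 9, 11, 13, 8, 10, 12], .witness [(5, -1), (9, 1)]]⟩,
   ⟨⟨[(0, [1, 3]), (1, [0, 4, 8]), (3, [0, 2, 6]), (2, [3, 5, 7]), (5, [2, 4, 12]), (4, [1, 5,
     9]), (6, [3]), (7, [2, 8, 10]), (8, [1, 7, 11]), (10, [7, 9]), (12, [5]), (9, [4, 10]), (11,
     [8])], []⟩, 10, 13, .embed 19 [10, 7, 9, 2], .embed 0 [5, 4, 2, 7, 8, 1, 3, 12, 0, 10, 6, 9,
     13, 11], [.witness [(8, -1), (10, 1)]]⟩,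
   ⟨⟨[(0, [1, 3, 7]), (1, [0, 4, 8]), (3, [0, 2, 6]), (2, [3, 5, 9]), (5, [2, 4, 10]), (4, [1, 5,
     11]), (6, [3]), (7, [0, 12, 14]), (9, [2, 8]), (8, [1, 9]), (10, [5]), (11, [4, 12]), (12,
     [7, 11]), (14, [7])], []⟩, 11, 16, .witness [(5, -1), (7, -1), (11, 2)], .witness [(3, 1),
     (5, -1), (7, -1), (11, 1)], [.embed 0 [6, 3, 11, 4, 5, 2, 12, 1, 0, 8, 10, 9, 7], .witness
     [(4, -1), (8, 1)], .witness [(5, -1), (11, 1)], .witness [(7, -1), (11, 1)]]⟩,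
   ⟨⟨[(0, [1, 3, 7]), (1, [0, 4, 8]), (3, [0, 2, 6]), (2, [3]), (5, [4]), (4, [1, 5, 13]), (6, [3,
     9]), (7, [0, 10, 12]), (9, [6, 10]), (11, [8]), (8, [1, 11, 15]), (13, [4, 14, 16]), (15, [8,
     18, 20]), (10, [7, 9]), (12, [7]), (14, [13]), (16, [13]), (18, [15]), (20, [15])], []⟩, 9,
     22, .witness [(1, -2), (7, 2), (9, -2), (13, 1), (15, 1)], .witness [(1, -2), (3, 1), (7, 1),
     (9, -1), (13, 1), (15, 1)], [.witness [(3, -1), (9, 1)], .witness [(7, -1), (9, 1)], .witness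
     [(1, -1), (7, 1), (9, -1), (13, 1)], .witness [(1, -1), (7, 1), (9, -1), (13, 1)], .witness
     [(1, -1), (7, 1), (9, -1), (15, 1)], .witness [(1, -1), (7, 1), (9, -1), (15, 1)]]⟩,
   ⟨⟨[(0, [1, 3, 5]), (1, [0, 2, 4]), (3, [0]), (2, [1, 7]), (5, [0]), (4, [1, 9]), (7, [2, 6,
     8]), (9, [4, 10, 12]), (6, [7]), (8, [7, 11]), (10, [9]), (12, [9, 11]), (11, [8, 12])], []⟩,
     11, 14, .witness [(7, -1), (9, -1), (11, 2)], .witness [(1, 1), (7, -1), (9, -1), (11, 1)],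
     [.witness [(7, -1), (11, 1)], .witness [(9, -1), (11, 1)], .witness [(7, -1), (11, 1)],
     .witness [(9, -1), (11, 1)]]⟩,
   ⟨⟨[(0, [1, 5]), (1, [0, 4, 6]), (2, [3, 7]), (3, [2, 4, 10]), (4, [1, 3, 9]), (5, [0, 12, 14]),
     (7, [2, 6, 8]), (6, [1, 7, 11]), (8, [7, 13]), (10, [3, 15]), (9, [4, 16, 18]), (11, [6, 20,
     22]), (12, [5]), (14, [5]), (16, [9]), (13, [8, 24, 26]), (18, [9]), (20, [11]), (22, [11]),
     (15, [10, 28]), (24, [13]), (26, [13]), (28, [15])], []⟩, 15, 30, .witness [(3, -2), (7, 2),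
     (11, -1), (13, -1), (15, 2)], .witness [(3, -2), (7, 2), (9, 1), (11, -1), (13, -1), (15,
     1)], [.witness [(3, -2), (7, 2), (9, 1), (11, -1), (13, -1), (15, 1)], .witness [(3, -1),
     (15, 1)], .embed 0 [11, 6, 20, 1, 22, 7, 4, 8, 9, 3, 13, 15, 10], .witness [(3, -2), (7, 2),
     (9, 1), (11, -1), (13, -1), (15, 1)], .witness [(3, -2), (7, 2), (9, 1), (11, -1), (13, -1),
     (15, 1)], .witness [(1, 2), (3, -1), (5, -1), (9, -1), (11, -1), (15, 1)], .witness [(1, 2),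
     (3, -1), (5, -1), (9, -1), (11, -1), (15, 1)], .witness [(3, -1), (7, 1), (11, -1), (15, 1)],
     .witness [(3, -1), (7, 1), (11, -1), (15, 1)], .witness [(3, -1), (7, 1), (13, -1), (15, 1)],
     .witness [(3, -1), (7, 1), (13, -1), (15, 1)]]⟩,
   ⟨⟨[(0, [1, 3, 7]), (1, [0, 4, 8]), (3, [0, 2, 6]), (2, [3, 11]), (5, [4]), (4, [1, 5, 13]), (6,
     [3, 9]), (7, [0, 12, 14]), (9, [6]), (11, [2, 8, 10]), (8, [1, 11, 15]), (10, [11, 17]), (13,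
     [4, 16, 18]), (15, [8, 20, 22]), (12, [7]), (14, [7]), (16, [13]), (17, [10, 24, 26]), (18,
     [13]), (20, [15]), (22, [15]), (24, [17]), (26, [17])], []⟩, 9, 28, .witness [(9, 1)], .embed
     0 [4, 1, 2, 3, 0, 13, 11, 8, 10, 6, 7, 15, 16, 18, 12, 17, 14, 20, 22, 9, 24, 26, 28],
     [.embed 23 [3, 2, 9, 6], .embed 1 [15, 8, 20, 1, 22, 11, 0, 10, 7, 3, 17, 9, 6], .embed 2 [0,
     1, 3, 2, 5, 4, 6, 7, 9, 11, 8, 13, 15, 12, 14, 16, 18, 20, 22], .embed 2 [0, 1, 3, 2, 5, 4,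
     6, 7, 9, 11, 8, 13, 15, 14, 12, 16, 18, 20, 22], .embed 1 [8, 1, 11, 0, 15, 4, 3, 13, 2, 6,
     18, 16, 9], .embed 1 [8, 1, 11, 0, 15, 4, 3, 13, 2, 6, 16, 18, 9], .embed 1 [4, 1, 5, 0, 13,
     8, 3, 15, 2, 6, 22, 20, 9], .embed 1 [4, 1, 5, 0, 13, 8, 3, 15, 2, 6, 20, 22, 9], .embed 1
     [8, 11, 1, 2, 15, 10, 3, 17, 0, 6, 26, 24, 9], .embed 1 [8, 11, 1, 2, 15, 10, 3, 17, 0, 6,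
     24, 26, 9]]⟩,
   ⟨⟨[(0, [1, 3, 7]), (1, [0, 4, 6]), (3, [0]), (2, [5, 9]), (5, [2, 4, 10]), (4, [1, 5, 11]), (7,
     [0, 12, 14]), (9, [2, 6, 8]), (6, [1, 9, 13]), (8, [9, 15]), (10, [5, 17]), (11, [4, 16,
     18]), (13, [6, 20, 22]), (12, [7]), (14, [7]), (16, [11]), (15, [8, 24]), (18, [11]), (20,
     [13]), (22, [13]), (17, [10]), (24, [15])], []⟩, 15, 26, .witness [(5, 1), (9, -2), (13, 1),
     (15, 2)], .embed 0 [4, 1, 5, 2, 3, 0, 10, 11, 17, 9, 6, 8, 7, 13, 16, 18, 12, 15, 14, 20, 22,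
     26, 24], [.witness [(9, -1), (15, 1)], .embed 2 [11, 4, 16, 1, 18, 5, 6, 10, 13, 9, 17, 15,
     8], .witness [(1, 1), (7, -1), (9, -1), (15, 1)], .witness [(1, 1), (7, -1), (9, -1), (15,
     1)], .witness [(5, 1), (9, -1), (11, -1), (15, 1)], .witness [(5, 1), (9, -1), (11, -1), (15,
     1)], .witness [(1, 2), (7, -1), (9, -1), (11, -1), (13, -1), (15, 1)], .witness [(1, 2), (7,
     -1), (9, -1), (11, -1), (13, -1), (15, 1)]]⟩,
   ⟨⟨[(0, [1, 3, 7]), (1, [0, 4, 8]), (3, [0, 2, 6]), (2, [3, 5]), (5, [2, 4, 10]), (4, [1, 5,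
     13]), (6, [3, 9]), (7, [0, 12, 14]), (9, [6]), (11, [8]), (8, [1, 11, 15]), (10, [5, 17]),
     (13, [4, 16, 18]), (15, [8, 20, 22]), (12, [7]), (14, [7]), (16, [13]), (17, [10]), (18,
     [13]), (20, [15]), (22, [15])], []⟩, 9, 24, .witness [(9, 1)], .embed 0 [8, 1, 11, 2, 5, 4,
     15, 3, 0, 6, 10, 13, 7, 20, 22, 16, 9, 18, 12, 14, 17, 24], [.embed 25 [3, 2, 9, 6], .embed 3
     [13, 4, 16, 1, 18, 5, 0, 10, 7, 3, 17, 9, 6], .embed 4 [0, 1, 3, 2, 5, 4, 6, 7, 9, 11, 8, 13,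
     15, 12, 14, 16, 18, 20, 22], .embed 4 [0, 1, 3, 2, 5, 4, 6, 7, 9, 11, 8, 13, 15, 14, 12, 16,
     18, 20, 22], .embed 3 [8, 1, 11, 0, 15, 4, 3, 13, 2, 6, 18, 16, 9], .embed 3 [8, 1, 11, 0,
     15, 4, 3, 13, 2, 6, 16, 18, 9], .embed 3 [4, 1, 5, 0, 13, 8, 3, 15, 2, 6, 22, 20, 9], .embed
     3 [4, 1, 5, 0, 13, 8, 3, 15, 2, 6, 20, 22, 9]]⟩,
   ⟨⟨[(0, [1, 3, 7]), (1, [0, 4, 8]), (3, [0, 2, 6]), (2, [3, 5, 11]), (5, [2, 4, 12]), (4, [1, 5,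
     15]), (6, [3, 9, 13]), (7, [0, 14]), (9, [6]), (11, [2, 8, 10]), (13, [6]), (8, [1, 11, 17]),
     (10, [11, 19, 21]), (12, [5, 23]), (15, [4, 16]), (17, [8]), (14, [7]), (19, [10]), (16,
     [15]), (21, [10]), (23, [12])], []⟩, 12, 25, .witness [(2, -2), (6, 1), (10, 1), (12, 2)],
     .embed 0 [3, 2, 0, 1, 4, 5, 7, 6, 14, 8, 11, 15, 12, 10, 9, 13, 25, 16, 23, 19, 21],
     [.witness [(0, -1), (2, -1), (6, 1), (8, 1), (12, 1)], .witness [(0, 1), (4, -1), (6, -1),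
     (12, 1)], .witness [(0, 1), (4, -1), (6, -1), (12, 1)], .witness [(4, -1), (12, 1)], .witness
     [(0, 1), (2, -1), (8, -1), (10, 1), (12, 1)], .witness [(4, -1), (8, 1), (10, -1), (12, 1)],
     .witness [(4, -1), (8, 1), (10, -1), (12, 1)]]⟩,
   ⟨⟨[(0, [1, 3, 7]), (1, [0, 4, 8]), (3, [0, 2, 6]), (2, [3, 5, 11]), (5, [2, 4, 12]), (4, [1, 5,
     15]), (6, [3, 9, 13]), (7, [0, 14]), (9, [6]), (11, [2, 8, 10]), (13, [6]), (8, [1, 11, 17]),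
     (10, [11, 19, 21]), (12, [5]), (15, [4, 16]), (17, [8]), (14, [7]), (19, [10]), (16, [15]),
     (21, [10])], []⟩, 12, 23, .witness [(12, 1)], .embed 0 [0, 1, 3, 2, 5, 4, 6, 7, 9, 11, 13, 8,
     10, 12, 15, 17, 14, 19, 16, 21, 23], [.embed 8 [8, 1, 11, 2, 3, 0, 10, 5, 4, 12, 6, 7, 15],
     .embed 7 [3, 2, 0, 1, 4, 5, 7, 6, 8, 11, 15, 12, 9, 13], .embed 7 [3, 2, 0, 1, 4, 5, 7, 6, 8,
     11, 15, 12, 13, 9], .witness [(5, -1), (15, 1)], .embed 8 [0, 1, 3, 2, 11, 8, 6, 5, 4, 12,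
     10, 17, 15], .embed 7 [11, 2, 8, 1, 4, 5, 17, 10, 0, 3, 15, 12, 19, 21], .embed 7 [11, 2, 8,
     1, 4, 5, 17, 10, 0, 3, 15, 12, 21, 19]]⟩,
   ⟨⟨[(0, [1, 3, 7]), (1, [0, 4, 8]), (3, [0, 2, 6]), (2, [3, 5, 11]), (5, [2, 4, 12]), (4, [1, 5,
     15]), (6, [3, 9, 13]), (7, [0, 14]), (9, [6]), (11, [2, 8, 10]), (13, [6]), (8, [1, 11, 17]),
     (10, [11, 19]), (12, [5]), (15, [4, 16]), (17, [8]), (14, [7]), (19, [10]), (16, [15])], []⟩,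
     10, 21, .witness [(2, -1), (4, 1), (8, -1), (10, 2)], .embed 0 [0, 1, 3, 2, 5, 4, 6, 7, 9,
     11, 13, 8, 10, 12, 15, 17, 14, 21, 16, 19], [.witness [(0, -1), (2, -1), (4, 1), (6, 1), (10,
     1)], .witness [(0, 1), (6, -1), (8, -1), (10, 1)], .witness [(0, 1), (6, -1), (8, -1), (10,
     1)], .embed 9 [0, 1, 3, 2, 5, 4, 6, 11, 8, 10, 12, 15, 17], .witness [(8, -1), (10, 1)]]⟩,
   ⟨⟨[(0, [1, 3, 7]), (1, [0, 4, 8]), (3, [0, 2, 6]), (2, [3, 5, 11]), (5, [2, 4, 12]), (4, [1, 5,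
     13]), (6, [3, 9]), (7, [0, 14, 16]), (9, [6]), (11, [2, 8, 10]), (8, [1, 11, 15]), (10, [11,
     17]), (12, [5]), (13, [4]), (15, [8]), (14, [7]), (16, [7]), (17, [10])], []⟩, 13, 18,
     .witness [(13, 1)], .embed 0 [3, 2, 0, 1, 8, 11, 7, 6, 14, 4, 16, 5, 13, 15, 10, 12, 9, 18,
     17], [.embed 10 [8, 1, 11, 2, 5, 4, 10, 3, 0, 6, 12, 13, 7], .embed 10 [0, 1, 3, 2, 5, 4, 6,
     11, 8, 10, 12, 13, 15], .embed 29 [5, 4, 13, 12], .embed 9 [0, 1, 3, 2, 5, 4, 6, 7, 11, 8,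
     12, 13, 14, 16], .embed 9 [0, 1, 3, 2, 5, 4, 6, 7, 11, 8, 12, 13, 16, 14]]⟩,
   ⟨⟨[(0, [1, 3, 7]), (1, [0, 4, 8]), (3, [0, 2, 6]), (2, [3, 5, 11]), (5, [2, 4, 12]), (4, [1, 5,
     15]), (6, [3, 9, 13]), (7, [0, 14, 16]), (9, [6]), (11, [2, 8, 10]), (13, [6]), (8, [1, 11,
     17]), (10, [11]), (12, [5]), (15, [4]), (17, [8]), (14, [7]), (16, [7])], []⟩, 10, 19,
     .witness [(10, 1)], .embed 0 [0, 1, 3, 2, 5, 4, 6, 7, 9, 11, 8, 10, 12, 15, 17, 14, 16, 19],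
     [.embed 8 [7, 0, 14, 1, 16, 3, 8, 6, 17, 11, 13, 9, 10], .embed 8 [7, 0, 14, 1, 16, 3, 8, 6,
     17, 11, 9, 13, 10], .embed 11 [0, 1, 3, 2, 5, 4, 6, 11, 8, 10, 12, 15, 17], .embed 30 [11, 8,
     17, 10]]⟩,
   ⟨⟨[(0, [1, 3, 7]), (1, [0, 4, 8]), (3, [0, 2, 6]), (2, [3, 5, 11]), (5, [2, 4, 12]), (4, [1, 5,
     15]), (6, [3, 9, 13]), (7, [0, 14]), (9, [6]), (11, [2, 8, 10]), (13, [6]), (8, [1, 11, 17]),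
     (10, [11]), (12, [5]), (15, [4]), (17, [8]), (14, [7])], []⟩, 7, 16, .witness [(1, -1), (3,
     -1), (7, 2), (11, 1)], .embed 0 [0, 1, 3, 2, 5, 4, 6, 7, 9, 11, 13, 8, 10, 12, 15, 17, 16,
     14], [.embed 12 [4, 1, 5, 2, 3, 0, 12, 11, 8, 10, 6, 7, 17], .embed 12 [8, 1, 11, 2, 3, 0,
     10, 5, 4, 12, 6, 7, 15]]⟩,
   ⟨⟨[(0, [1, 3, 7]), (1, [0, 4, 8]), (3, [0, 2, 6]), (2, [3, 5, 11]), (5, [2, 4, 12]), (4, [1, 5,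
     15]), (6, [3, 9, 13]), (7, [0]), (9, [6]), (11, [2, 8, 10]), (13, [6]), (8, [1, 11, 17]),
     (10, [11]), (12, [5]), (15, [4]), (17, [8])], []⟩, 7, 14, .witness [(7, 1)], .embed 0 [0, 1,
     3, 2, 5, 4, 6, 7, 9, 11, 13, 8, 10, 12, 15, 17, 14], [.embed 13 [4, 1, 5, 2, 3, 0, 12, 11, 8,
     10, 6, 7, 17], .embed 13 [8, 1, 11, 2, 3, 0, 10, 5, 4, 12, 6, 7, 15]]⟩,
   ⟨⟨[(0, [1, 3, 7]), (1, [0, 4, 8]), (3, [0, 2, 6]), (2, [3, 5, 11]), (5, [2, 4, 12]), (4, [1, 5,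
     15]), (6, [3, 9, 13]), (7, [0]), (9, [6]), (11, [2, 8, 10]), (13, [6]), (8, [1, 11]), (10,
     [11]), (12, [5]), (15, [4])], []⟩, 8, 17, .witness [(0, -1), (2, -1), (6, 1), (8, 2)], .embed
     0 [0, 1, 3, 2, 5, 4, 6, 7, 9, 11, 13, 8, 10, 12, 15, 17], [.witness [(0, -1), (8, 1)], .embed
     14 [4, 1, 5, 2, 11, 8, 12, 3, 0, 6, 10, 9, 7], .embed 14 [4, 1, 5, 2, 11, 8, 12, 3, 0, 6, 10,
     13, 7], .witness [(4, -1), (8, 1)]]⟩,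
   ⟨⟨[(0, [1, 3, 7]), (1, [0, 4, 8]), (3, [0, 2, 6]), (2, [3, 5, 11]), (5, [2, 4, 12]), (4, [1,
     5]), (6, [3, 9, 13]), (7, [0]), (9, [6]), (11, [2, 8, 10]), (13, [6]), (8, [1, 11]), (10,
     [11]), (12, [5])], []⟩, 4, 15, .witness [(0, -1), (2, -1), (4, 2), (6, 1)], .embed 0 [0, 1,
     3, 2, 5, 4, 6, 7, 9, 11, 13, 8, 10, 12, 15], [.witness [(0, -1), (4, 1)], .embed 15 [8, 1,
     11, 2, 5, 4, 10, 3, 0, 6, 12, 9, 7], .embed 15 [8, 1, 11, 2, 5, 4, 10, 3, 0, 6, 12, 13, 7]]⟩,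
   ⟨⟨[(0, [1, 3, 7]), (1, [0, 4, 10]), (3, [0, 2, 6]), (2, [3, 5, 11]), (5, [2, 4, 8]), (4, [1, 5,
     15]), (6, [3, 9, 13]), (7, [0, 12]), (9, [6]), (11, [2]), (13, [6]), (8, [5]), (15, [4, 12]),
     (10, [1]), (12, [7, 15])], []⟩, 7, 14, .witness [(1, -1), (3, -1), (5, 1), (7, 2)], .embed 13
     [6, 3, 9, 0, 13, 2, 7, 5, 14, 12, 8, 4, 15], [.embed 0 [2, 5, 3, 0, 1, 4, 6, 11, 9, 7, 13, 8,
     12, 10], .witness [(1, -1), (7, 1)]]⟩,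
   ⟨⟨[(0, [1, 3, 7]), (1, [0, 4, 10]), (3, [0, 2, 6]), (2, [3, 5]), (5, [2, 4, 8]), (4, [1, 5,
     9]), (6, [3]), (7, [0, 8]), (8, [5, 7]), (9, [4]), (10, [1, 11, 13]), (11, [10]), (13,
     [10])], []⟩, 7, 12, .embed 37 [7, 0, 8, 1], .embed 1 [4, 5, 1, 0, 3, 2, 10, 9, 11, 7, 13, 8,
     12, 6], [.witness [(0, -1), (2, 1)], .witness [(3, -1), (7, 1)]]⟩,
   ⟨⟨[(0, [1, 3, 7]), (1, [0, 4, 8]), (3, [0, 2]), (2, [3, 5, 9]), (5, [2, 4, 6]), (4, [1, 5,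
     11]), (7, [0, 12]), (9, [2]), (6, [5]), (11, [4, 10]), (8, [1, 13]), (10, [11, 13]), (13, [8,
     10, 12]), (12, [7, 13])], []⟩, 10, 15, .embed 38 [10, 11, 13, 4], .embed 15 [5, 4, 2, 1, 6,
     11, 0, 10, 3, 7, 15, 13, 12], [.embed 0 [0, 3, 1, 8, 13, 10, 4, 7, 12, 11, 2, 5, 9], .witness
     [(7, -1), (13, 1)], .embed 27 [6, 0, 1, 4, 5, 3, 12, 2, 8, 13, 9, 10]]⟩,
   ⟨⟨[(0, [1, 3, 7]), (1, [0, 4, 10]), (3, [0, 2, 6]), (2, [3, 5]), (5, [2, 4, 8]), (4, [1, 5,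
     9]), (6, [3]), (7, [0, 16, 18]), (8, [5]), (9, [4, 12, 14]), (10, [1, 11, 13]), (12, [9,
     11]), (14, [9]), (11, [10, 12, 20]), (13, [10, 16]), (16, [7, 13]), (18, [7]), (20, [11])],
     []⟩, 13, 22, .witness [(7, -1), (11, -1), (13, 2)], .witness [(3, 1), (5, -1), (7, -1), (9,
     1), (11, -1), (13, 1)], [.witness [(5, -1), (9, 1), (11, -1), (13, 1)], .embed 1 [0, 1, 3, 6,
     13, 10, 2, 7, 16, 11, 4, 5, 9], .witness [(5, -1), (9, 1), (11, -1), (13, 1)], .witness [(10,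
     -1), (12, 1)], .embed 1 [10, 1, 11, 12, 9, 4, 20, 13, 14, 5, 0, 3, 7], .witness [(7, -1),
     (13, 1)], .witness [(11, -1), (13, 1)]]⟩,
   ⟨⟨[(0, [1, 3, 7]), (1, [0, 4, 10]), (3, [0, 2]), (2, [3, 5, 9]), (5, [2, 4, 8]), (4, [1, 5,
     11]), (7, [0, 16]), (9, [2, 6]), (6, [9]), (8, [5, 17, 19]), (11, [4, 12, 14]), (10, [1, 13,
     15]), (12, [11, 13]), (14, [11, 21]), (13, [10, 12]), (15, [10]), (17, [8]), (19, [8]), (16,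
     [7]), (21, [14])], []⟩, 14, 23, .witness [(4, -2), (8, 1), (10, 1), (14, 2)], .embed 13 [1,
     4, 0, 3, 2, 5, 7, 10, 16, 12, 11, 9, 8, 14, 13, 15, 17, 6, 19, 23, 21], [.embed 2 [4, 1, 5,
     2, 3, 0, 8, 11, 14, 7, 10, 13, 15], .witness [(0, -1), (2, 1), (4, -1), (10, 1), (14, 1)],
     .witness [(0, 1), (2, -1), (4, -1), (8, 1), (14, 1)], .witness [(11, -1), (13, 1)], .embed 2
     [11, 4, 14, 15, 10, 1, 21, 12, 13, 0, 5, 2, 8], .embed 0 [1, 4, 0, 3, 2, 5, 7, 10, 9, 8, 11,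
     17, 19, 14, 12, 13, 15, 21], .embed 0 [1, 4, 0, 3, 2, 5, 7, 10, 9, 8, 11, 19, 17, 14, 12, 13,
     15, 21]]⟩,
   ⟨⟨[(0, [1, 3, 7]), (1, [0, 4, 10]), (3, [0, 2]), (2, [3, 5, 9]), (5, [2, 4, 8]), (4, [1, 5,
     11]), (7, [0, 16]), (9, [2, 6]), (6, [9]), (8, [5, 17, 19]), (11, [4, 12, 14]), (10, [1, 13,
     15]), (12, [11, 13, 21]), (14, [11]), (13, [10, 12]), (15, [10]), (17, [8]), (19, [8]), (16,
     [7]), (21, [12])], []⟩, 14, 23, .witness [(14, 1)], .embed 0 [0, 1, 3, 2, 5, 4, 7, 9, 6, 8,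
     11, 10, 12, 14, 13, 15, 17, 19, 16, 23], [.embed 3 [4, 1, 5, 2, 3, 0, 8, 11, 14, 7, 10, 13,
     15], .embed 18 [12, 11, 13, 4, 21, 14, 5, 7, 8, 2, 16, 0, 3], .embed 18 [12, 11, 13, 4, 21,
     14, 1, 9, 10, 0, 6, 2, 3], .witness [(11, -1), (13, 1)], .embed 3 [11, 4, 12, 13, 10, 1, 21,
     14, 15, 0, 5, 2, 8], .embed 1 [5, 4, 2, 3, 0, 1, 9, 8, 7, 10, 11, 13, 15, 12, 14, 17, 19,
     21], .embed 1 [5, 4, 2, 3, 0, 1, 9, 8, 7, 10, 11, 13, 15, 12, 14, 19, 17, 21], .embed 40 [11,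
     12, 21, 14]]⟩,
   ⟨⟨[(0, [1, 3, 7]), (1, [0, 4, 12]), (3, [0, 2, 6]), (2, [3, 5, 9]), (5, [2, 4, 10]), (4, [1, 5,
     11]), (6, [3]), (7, [0, 18]), (9, [2, 8]), (8, [9]), (10, [5, 17, 19]), (11, [4, 14, 16]),
     (12, [1, 13, 15]), (14, [11, 13]), (16, [11]), (13, [12, 14]), (15, [12]), (17, [10]), (19,
     [10]), (18, [7])], []⟩, 14, 21, .witness [(0, 1), (4, -1), (12, -1), (14, 2)], .embed 0 [0,
     1, 3, 2, 5, 4, 7, 9, 8, 10, 11, 12, 14, 16, 13, 15, 17, 19, 18, 21], [.witness [(3, 1), (5,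
     -1), (7, -1), (11, 1)], .witness [(0, 1), (2, -1), (12, -1), (14, 1)], .witness [(12, -1),
     (14, 1)], .embed 3 [1, 4, 0, 3, 2, 5, 12, 6, 9, 10, 11, 17, 14, 13], .embed 3 [1, 4, 0, 3, 2,
     5, 12, 6, 9, 10, 11, 19, 14, 13]]⟩,
   ⟨⟨[(0, [1, 3, 7]), (1, [0, 4, 10]), (3, [0, 2, 6]), (2, [3, 5, 11]), (5, [2, 4]), (4, [1, 5,
     15]), (6, [3, 9, 13]), (7, [0, 14, 16]), (9, [6]), (11, [2, 8]), (13, [6]), (8, [11]), (15,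
     [4, 12]), (10, [1, 17, 19]), (12, [15]), (17, [10]), (19, [10]), (14, [7]), (16, [7, 21]),
     (21, [16])], []⟩, 16, 23, .witness [(0, -2), (6, 1), (10, 1), (16, 2)], .embed 16 [1, 0, 4,
     5, 2, 3, 15, 10, 12, 14, 7, 11, 6, 16, 17, 19, 9, 8, 13, 23, 21], [.embed 5 [0, 1, 3, 2, 5,
     4, 6, 7, 16, 15, 10, 17, 19], .embed 1 [2, 3, 5, 4, 1, 0, 11, 15, 12, 10, 7, 6, 16, 14, 9,
     13, 17, 19, 8, 21], .witness [(0, -1), (2, -1), (4, 1), (6, 1), (16, 1)], .embed 1 [2, 3, 5,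
     4, 1, 0, 11, 15, 12, 10, 7, 6, 16, 14, 13, 9, 17, 19, 8, 21], .witness [(0, -1), (2, 1), (4,
     -1), (10, 1), (16, 1)], .embed 1 [4, 1, 5, 2, 3, 0, 15, 11, 8, 6, 7, 10, 16, 14, 17, 19, 9,
     13, 12, 21], .embed 1 [4, 1, 5, 2, 3, 0, 15, 11, 8, 6, 7, 10, 16, 14, 19, 17, 9, 13, 12,
     21]]⟩,
   ⟨⟨[(0, [1, 3, 7]), (1, [0, 4, 14]), (3, [0, 2, 6]), (2, [3, 5, 11]), (5, [2, 4, 12]), (4, [1,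
     5, 15]), (6, [3, 9, 13]), (7, [0, 16, 18]), (9, [6]), (11, [2, 8, 10]), (13, [6]), (8, [11]),
     (10, [11]), (12, [5, 19]), (15, [4]), (14, [1, 17]), (17, [14]), (19, [12]), (16, [7]), (18,
     [7])], []⟩, 9, 20, .witness [(9, 1)], .embed 0 [3, 0, 2, 5, 4, 1, 11, 6, 8, 12, 10, 19, 14,
     7, 17, 16, 18, 13, 9, 20], [.embed 1 [5, 2, 4, 1, 0, 3, 15, 12, 14, 17, 7, 6, 11, 9, 13, 8,
     10, 16, 18, 19], .embed 1 [5, 2, 4, 1, 0, 3, 15, 12, 14, 17, 7, 6, 11, 9, 13, 10, 8, 16, 18,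
     19], .witness [(0, 1), (4, -1), (6, -1), (12, 1)], .witness [(2, 1), (4, -1), (6, -1), (14,
     1)], .embed 1 [1, 0, 4, 5, 2, 3, 15, 14, 12, 19, 11, 6, 7, 9, 13, 16, 18, 8, 10, 17], .embed
     1 [1, 0, 4, 5, 2, 3, 15, 14, 12, 19, 11, 6, 7, 9, 13, 18, 16, 8, 10, 17]]⟩,
   ⟨⟨[(0, [1, 3, 7]), (1, [0, 4, 14]), (3, [0, 2, 6]), (2, [3, 5, 9]), (5, [2, 4, 12]), (4, [1, 5,
     13]), (6, [3, 11]), (7, [0]), (9, [2, 8, 10]), (11, [6]), (8, [9]), (10, [9]), (12, [5, 17]),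
     (13, [4, 16, 18]), (14, [1, 15]), (16, [13]), (18, [13]), (15, [14]), (17, [12])], []⟩, 12,
     19, .witness [(0, 1), (2, -1), (4, -1), (12, 2)], .embed 0 [2, 3, 5, 4, 1, 0, 12, 9, 19, 13,
     17, 16, 18, 14, 7, 6, 11, 15, 8, 10], [.embed 7 [5, 2, 4, 1, 0, 3, 13, 12, 7, 6, 9, 8, 10],
     .embed 22 [13, 4, 16, 1, 18, 5, 0, 12, 7, 3, 17, 11, 6], .embed 22 [9, 2, 8, 3, 10, 5, 0, 12,
     7, 1, 17, 15, 14]]⟩,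
   ⟨⟨[(0, [1, 3, 7]), (1, [0, 4, 12]), (3, [0, 2, 6]), (2, [3, 5, 11]), (5, [2, 4, 10]), (4, [1,
     5, 15]), (6, [3, 9, 13]), (7, [0]), (9, [6]), (11, [2, 8]), (13, [6]), (8, [11]), (10, [5]),
     (15, [4, 14]), (12, [1, 17, 19]), (14, [15]), (17, [12]), (19, [12])], []⟩, 7, 16, .witness
     [(7, 1)], .embed 0 [5, 2, 4, 1, 0, 3, 15, 10, 12, 14, 17, 19, 7, 6, 11, 9, 13, 8, 16],
     [.embed 9 [0, 3, 1, 4, 5, 2, 12, 7, 17, 15, 19, 10, 11, 6, 8], .embed 8 [0, 1, 3, 2, 5, 4, 6,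
     7, 10, 15, 12, 17, 19], .embed 9 [0, 1, 3, 2, 5, 4, 6, 7, 9, 11, 13, 10, 15, 12, 14]]⟩,
   ⟨⟨[(0, [1, 3, 7]), (1, [0, 4, 14]), (3, [0, 2, 6]), (2, [3, 5, 11]), (5, [2, 4, 12]), (4, [1,
     5, 13]), (6, [3, 9]), (7, [0]), (9, [6]), (11, [2, 8, 10]), (8, [11]), (10, [11]), (12, [5]),
     (13, [4, 16, 18]), (14, [1]), (16, [13]), (18, [13])], []⟩, 14, 15, .witness [(14, 1)],
     .embed 0 [5, 2, 4, 1, 0, 3, 13, 12, 16, 14, 18, 15, 7, 6, 11, 9, 8, 10], [.embed 46 [0, 1,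
     14, 7], .embed 10 [1, 0, 4, 5, 2, 3, 13, 14, 16, 12, 18, 11, 6, 7, 9]]⟩,
   ⟨⟨[(0, [1, 3, 7]), (1, [0, 4, 14]), (3, [0, 2, 6]), (2, [3, 5, 9]), (5, [2, 4, 12]), (4, [1, 5,
     13]), (6, [3, 11]), (7, [0]), (9, [2, 8, 10]), (11, [6]), (8, [9]), (10, [9]), (12, [5]),
     (13, [4, 16]), (14, [1]), (16, [13])], []⟩, 13, 18, .witness [(1, -1), (3, 1), (5, -1), (13,
     2)], .embed 0 [0, 1, 3, 2, 5, 4, 6, 7, 11, 9, 8, 10, 12, 13, 14, 18, 16], [.embed 10 [3, 2,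
     0, 1, 4, 5, 7, 6, 13, 12, 9, 8, 10], .witness [(1, -1), (3, 1), (9, -1), (13, 1)], .witness
     [(1, -1), (3, 1), (9, -1), (13, 1)], .witness [(5, -1), (13, 1)], .witness [(1, -1), (13,
     1)]]⟩,
   ⟨⟨[(0, [1, 3, 7]), (1, [0, 4, 14]), (3, [0, 2, 6]), (2, [3, 5, 11]), (5, [2, 4, 12]), (4, [1,
     5, 15]), (6, [3, 9, 13]), (7, [0]), (9, [6]), (11, [2, 8, 10]), (13, [6]), (8, [11]), (10,
     [11]), (12, [5]), (15, [4]), (14, [1])], []⟩, 15, 16, .witness [(15, 1)], .embed 0 [0, 1, 3,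
     2, 5, 4, 6, 7, 11, 9, 8, 10, 12, 15, 14, 16], [.embed 26 [6, 3, 9, 0, 13, 2, 1, 11, 14, 4,
     10, 8, 15], .embed 26 [6, 3, 9, 0, 13, 2, 1, 11, 14, 4, 8, 10, 15], .embed 48 [5, 4, 15, 12],
     .embed 48 [1, 4, 15, 14]]⟩,
   ⟨⟨[(0, [1, 3, 7]), (1, [0, 4]), (3, [0, 2, 6]), (2, [3, 5, 11]), (5, [2, 4, 12]), (4, [1, 5,
     15]), (6, [3, 9, 13]), (7, [0]), (9, [6]), (11, [2, 8, 10]), (13, [6]), (8, [11]), (10,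
     [11]), (12, [5]), (15, [4])], []⟩, 1, 14, .witness [(1, 2), (3, -1), (5, -1), (11, 1)],
     .embed 0 [0, 1, 3, 2, 5, 4, 6, 7, 9, 11, 13, 8, 10, 12, 15, 14], [.embed 12 [2, 3, 5, 4, 1,
     0, 12, 11, 8, 7, 6, 9, 13], .embed 12 [2, 3, 5, 4, 1, 0, 12, 11, 10, 7, 6, 9, 13], .witness
     [(1, -1), (5, 1)]]⟩,
   -- The end of the hexagon group: the hexagon `0, 1, 4, 5, 2, 3` with some branches and no other
   -- cycle.
   ⟨⟨[(0, [1, 3, 7]), (1, [0, 4]), (3, [0, 2, 6]), (2, [3, 5, 11]), (5, [2, 4, 12]), (4, [1, 5]),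
     (6, [3, 9, 13]), (7, [0]), (9, [6]), (11, [2, 8, 10]), (13, [6]), (8, [11]), (10, [11]), (12,
     [5])], []⟩, 1, 14, .witness [(1, 2), (3, -1), (5, -1), (11, 1)], .embed 0 [5, 4, 2, 3, 0, 1,
     11, 12, 8, 6, 10, 9, 13, 7, 14], [.embed 13 [2, 3, 5, 4, 1, 0, 12, 11, 8, 7, 6, 9, 13],
     .embed 13 [2, 3, 5, 4, 1, 0, 12, 11, 10, 7, 6, 9, 13], .witness [(1, -1), (5, 1)]]⟩,
   -- From here on the patterns are trees. When `13` gets its third neighbour, the vector with `-3`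
   -- at `3` and `1` at the six labels at distance two has squared norm `9 + 6`. Its image is `-1`
   -- at the three neighbours of `3` and `1` at the twelve leaves, so it has squared norm `3 + 12`.
   ⟨⟨[(0, [1, 3, 7]), (1, [0, 14, 20]), (3, [0, 2, 6]), (2, [3, 5, 11]), (5, [2, 4, 12]), (4,
     [5]), (6, [3, 9, 13]), (7, [0, 16, 18]), (9, [6, 24, 26]), (11, [2, 8, 10]), (13, [6, 22]),
     (8, [11]), (10, [11]), (12, [5]), (14, [1]), (16, [7]), (18, [7]), (20, [1]), (22, [13]),
     (24, [9]), (26, [9])], []⟩, 13, 28, .witness [(3, -2), (7, 1), (11, 1), (13, 2)], .witness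
     [(1, 1), (3, -3), (5, 1), (7, 1), (9, 1), (11, 1), (13, 1)], [.embed 0 [2, 5, 3, 6, 13, 4, 0,
     11, 1, 9, 7, 24, 26, 22], .embed 0 [2, 11, 3, 6, 13, 8, 0, 5, 1, 9, 7, 24, 26, 22], .embed 0
     [2, 11, 3, 6, 13, 10, 0, 5, 1, 9, 7, 24, 26, 22], .embed 0 [2, 5, 3, 6, 13, 12, 0, 11, 1, 9,
     7, 24, 26, 22], .embed 0 [0, 1, 3, 6, 13, 14, 2, 7, 5, 9, 11, 24, 26, 22], .embed 0 [0, 7, 3,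
     6, 13, 16, 2, 1, 5, 9, 11, 24, 26, 22], .embed 0 [0, 7, 3, 6, 13, 18, 2, 1, 5, 9, 11, 24, 26,
     22], .embed 0 [0, 1, 3, 6, 13, 20, 2, 7, 5, 9, 11, 24, 26, 22], .witness [(9, -1), (13, 1)],
     .witness [(9, -1), (13, 1)]]⟩,
   ⟨⟨[(0, [1, 3, 7]), (1, [0, 14, 20]), (3, [0, 2, 6]), (2, [3, 5, 11]), (5, [2, 4, 12]), (4,
     [5]), (6, [3, 9, 13]), (7, [0, 16, 18]), (9, [6, 24]), (11, [2, 8, 10]), (13, [6, 22]), (8,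
     [11]), (10, [11]), (12, [5]), (14, [1]), (16, [7]), (18, [7]), (20, [1]), (22, [13]), (24,
     [9])], []⟩, 9, 26, .witness [(3, -2), (7, 1), (9, 2), (11, 1)], .embed 0 [0, 1, 3, 2, 5, 4,
     6, 7, 9, 11, 13, 8, 10, 12, 14, 16, 18, 20, 22, 26, 24], [.embed 1 [5, 4, 2, 3, 6, 9, 11, 12,
     8, 0, 10, 1, 7, 13], .embed 1 [6, 9, 3, 2, 11, 8, 0, 13, 1, 5, 7, 4, 12, 10], .embed 1 [6, 9,
     3, 2, 11, 10, 0, 13, 1, 5, 7, 4, 12, 8], .embed 1 [5, 12, 2, 3, 6, 9, 11, 4, 8, 0, 10, 1, 7,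
     13], .embed 1 [1, 14, 0, 3, 6, 9, 7, 20, 16, 2, 18, 5, 11, 13], .embed 1 [6, 9, 3, 0, 7, 16,
     2, 13, 5, 1, 11, 14, 20, 18], .embed 1 [6, 9, 3, 0, 7, 18, 2, 13, 5, 1, 11, 14, 20, 16],
     .embed 1 [1, 20, 0, 3, 6, 9, 7, 14, 16, 2, 18, 5, 11, 13], .embed 52 [6, 9, 22, 13]]⟩,
   ⟨⟨[(0, [1, 3, 7]), (1, [0, 14, 20]), (3, [0, 2, 6]), (2, [3, 5, 11]), (5, [2, 4, 12]), (4,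
     [5]), (6, [3, 9, 13]), (7, [0, 16, 18]), (9, [6]), (11, [2, 8, 10]), (13, [6, 22]), (8,
     [11]), (10, [11]), (12, [5]), (14, [1]), (16, [7]), (18, [7]), (20, [1]), (22, [13])], []⟩,
     9, 24, .witness [(9, 1)], .embed 0 [0, 1, 3, 2, 5, 4, 6, 7, 9, 11, 13, 8, 10, 12, 14, 16, 18,
     20, 22, 24], [.embed 2 [5, 4, 2, 3, 6, 9, 11, 12, 8, 0, 10, 1, 7, 13], .embed 2 [6, 9, 3, 2,
     11, 8, 0, 13, 1, 5, 7, 4, 12, 10], .embed 2 [6, 9, 3, 2, 11, 10, 0, 13, 1, 5, 7, 4, 12, 8],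
     .embed 2 [5, 12, 2, 3, 6, 9, 11, 4, 8, 0, 10, 1, 7, 13], .embed 2 [1, 14, 0, 3, 6, 9, 7, 20,
     16, 2, 18, 5, 11, 13], .embed 2 [6, 9, 3, 0, 7, 16, 2, 13, 5, 1, 11, 14, 20, 18], .embed 2
     [6, 9, 3, 0, 7, 18, 2, 13, 5, 1, 11, 14, 20, 16], .embed 2 [1, 20, 0, 3, 6, 9, 7, 14, 16, 2,
     18, 5, 11, 13], .embed 53 [6, 9, 22, 13]]⟩,
   ⟨⟨[(0, [1, 3, 7]), (1, [0, 14, 20]), (3, [0, 2, 6]), (2, [3, 5, 11]), (5, [2, 4, 12]), (4,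
     [5]), (6, [3, 9, 13]), (7, [0, 16, 18]), (9, [6]), (11, [2, 8, 10]), (13, [6]), (8, [11]),
     (10, [11]), (12, [5]), (14, [1]), (16, [7]), (18, [7]), (20, [1])], []⟩, 9, 22, .witness [(9,
     1)], .embed 0 [0, 1, 3, 2, 5, 4, 6, 7, 13, 11, 9, 8, 10, 12, 14, 16, 18, 20, 22], [.embed 3
     [5, 4, 2, 3, 6, 9, 11, 12, 8, 0, 10, 1, 7, 13], .embed 3 [6, 9, 3, 2, 11, 8, 0, 13, 1, 5, 7,
     4, 12, 10], .embed 3 [6, 9, 3, 2, 11, 10, 0, 13, 1, 5, 7, 4, 12, 8], .embed 3 [5, 12, 2, 3,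
     6, 9, 11, 4, 8, 0, 10, 1, 7, 13], .embed 3 [1, 14, 0, 3, 6, 9, 7, 20, 16, 2, 18, 5, 11, 13],
     .embed 3 [6, 9, 3, 0, 7, 16, 2, 13, 5, 1, 11, 14, 20, 18], .embed 3 [6, 9, 3, 0, 7, 18, 2,
     13, 5, 1, 11, 14, 20, 16], .embed 3 [1, 20, 0, 3, 6, 9, 7, 14, 16, 2, 18, 5, 11, 13]]⟩,
   ⟨⟨[(0, [1, 3, 7]), (1, [0, 14]), (3, [0, 2, 6]), (2, [3, 5, 11]), (5, [2, 4, 12]), (4, [5]),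
     (6, [3, 9, 13]), (7, [0, 16, 18]), (9, [6]), (11, [2, 8, 10]), (13, [6]), (8, [11]), (10,
     [11]), (12, [5]), (14, [1]), (16, [7]), (18, [7])], []⟩, 1, 20, .embed 56 [1, 0, 14, 3],
     .embed 0 [0, 1, 3, 2, 5, 4, 6, 7, 9, 11, 13, 8, 10, 12, 20, 16, 18, 14], [.embed 4 [0, 1, 3,
     2, 5, 4, 6, 7, 9, 11, 13, 8, 10, 12], .embed 4 [0, 1, 3, 2, 11, 8, 6, 7, 9, 5, 13, 4, 12,
     10], .embed 4 [0, 1, 3, 2, 11, 10, 6, 7, 9, 5, 13, 4, 12, 8], .embed 4 [0, 1, 3, 2, 5, 12, 6,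
     7, 9, 11, 13, 8, 10, 4], .witness [(1, -1), (7, 1)], .witness [(1, -1), (7, 1)]]⟩,
   ⟨⟨[(0, [1, 3, 7]), (1, [0]), (3, [0, 2, 6]), (2, [3, 5, 11]), (5, [2, 4, 12]), (4, [5]), (6,
     [3, 9, 13]), (7, [0]), (9, [6]), (11, [2, 8, 10]), (13, [6]), (8, [11, 15]), (10, [11, 17]),
     (12, [5]), (15, [8]), (17, [10])], []⟩, 8, 19, .embed 57 [8, 11, 15, 2], .embed 0 [11, 10, 2,
     3, 0, 1, 5, 8, 4, 6, 12, 9, 13, 7, 17, 19, 15], [.embed 5 [0, 1, 3, 2, 11, 8, 6, 7, 9, 5, 13,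
     4, 12, 10], .embed 5 [0, 7, 3, 2, 11, 8, 6, 1, 9, 5, 13, 4, 12, 10], .embed 5 [6, 9, 3, 2,
     11, 8, 0, 13, 1, 5, 7, 4, 12, 10], .embed 5 [6, 13, 3, 2, 11, 8, 0, 9, 1, 5, 7, 4, 12, 10],
     .embed 56 [11, 8, 17, 10]]⟩,
   ⟨⟨[(0, [1, 3, 7]), (1, [0]), (3, [0, 2, 6]), (2, [3, 5, 11]), (5, [2, 4, 12]), (4, [5]), (6,
     [3, 9, 13]), (7, [0]), (9, [6]), (11, [2, 8, 10]), (13, [6]), (8, [11, 15]), (10, [11]), (12,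
     [5]), (15, [8])], []⟩, 10, 17, .witness [(10, 1)], .embed 0 [0, 1, 3, 2, 5, 4, 6, 7, 9, 11,
     13, 8, 10, 12, 15, 17], [.embed 6 [0, 1, 3, 2, 11, 10, 6, 7, 9, 5, 13, 4, 12, 8], .embed 6
     [0, 7, 3, 2, 11, 10, 6, 1, 9, 5, 13, 4, 12, 8], .embed 6 [6, 9, 3, 2, 11, 10, 0, 13, 1, 5, 7,
     4, 12, 8], .embed 6 [6, 13, 3, 2, 11, 10, 0, 9, 1, 5, 7, 4, 12, 8], .embed 57 [11, 8, 15,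
     10]]⟩,
   ⟨⟨[(0, [1, 3, 7]), (1, [0]), (3, [0, 2, 6]), (2, [3, 5, 11]), (5, [2, 4, 12]), (4, [5]), (6,
     [3, 9, 13]), (7, [0]), (9, [6]), (11, [2, 8, 10]), (13, [6]), (8, [11]), (10, [11]), (12,
     [5])], []⟩, 1, 14, .witness [(1, 1)], .embed 0 [5, 4, 2, 3, 6, 9, 11, 12, 8, 0, 10, 1, 7, 13,
     14], [.embed 7 [0, 1, 3, 2, 5, 4, 6, 7, 9, 11, 13, 8, 10, 12], .embed 7 [0, 1, 3, 2, 11, 8,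
     6, 7, 9, 5, 13, 4, 12, 10], .embed 7 [0, 1, 3, 2, 11, 10, 6, 7, 9, 5, 13, 4, 12, 8], .embed 7
     [0, 1, 3, 2, 5, 12, 6, 7, 9, 11, 13, 8, 10, 4]]⟩,
   ⟨⟨[(0, [1, 3, 7]), (1, [0]), (3, [0, 2, 6]), (2, [3, 5, 11]), (5, [2, 4]), (4, [5]), (6, [3, 9,
     13]), (7, [0]), (9, [6]), (11, [2, 8, 10]), (13, [6]), (8, [11]), (10, [11])], []⟩, 5, 12,
     .embed 60 [5, 2, 4, 3], .embed 0 [0, 1, 3, 2, 5, 12, 6, 7, 9, 11, 13, 8, 10, 4], [.witness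
     [(5, -1), (11, 1)], .witness [(5, -1), (11, 1)]]⟩,
   ⟨⟨[(0, [1, 3, 7]), (1, [0]), (3, [0, 2, 6]), (2, [3, 5, 11]), (5, [2, 4]), (4, [5]), (6, [3, 9,
     13]), (7, [0]), (9, [6]), (11, [2, 8]), (13, [6]), (8, [11])], []⟩, 5, 10, .embed 61 [5, 2,
     4, 3], .embed 0 [0, 1, 3, 2, 11, 8, 6, 7, 9, 5, 13, 10, 4], [.embed 60 [2, 5, 8, 11]]⟩,
   ⟨⟨[(0, [1, 3, 7]), (1, [0]), (3, [0, 2, 6]), (2, [3, 5, 11]), (5, [2, 4]), (4, [5]), (6, [3, 9,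
     13]), (7, [0]), (9, [6]), (11, [2]), (13, [6])], []⟩, 11, 8, .witness [(11, 1)], .embed 0 [0,
     1, 3, 2, 5, 4, 6, 7, 9, 11, 13, 8], [.embed 61 [2, 5, 4, 11]]⟩,
   ⟨⟨[(0, [1, 3, 7]), (1, [0]), (3, [0, 2, 6]), (2, [3, 5, 11]), (5, [2, 4]), (4, [5]), (6, [3,
     9]), (7, [0]), (9, [6]), (11, [2])], []⟩, 6, 13, .embed 63 [6, 3, 9, 0], .embed 0 [0, 1, 3,
     2, 5, 4, 6, 7, 13, 11, 9], [.witness [(0, -1), (6, 1)], .witness [(2, -1), (6, 1)], .witness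
     [(0, -1), (6, 1)], .witness [(2, -1), (6, 1)]]⟩,
   ⟨⟨[(0, [1, 3, 7]), (1, [0]), (3, [0, 2, 6]), (2, [3, 5]), (5, [2, 4]), (4, [5]), (6, [3, 9]),
     (7, [0]), (9, [6])], []⟩, 2, 11, .embed 64 [2, 3, 5, 0], .embed 0 [0, 1, 3, 2, 5, 4, 6, 7, 9,
     11], [.witness [(0, -1), (2, 1)], .witness [(0, -1), (2, 1)], .embed 63 [3, 2, 9, 6]]⟩,
   ⟨⟨[(0, [1, 3, 7]), (1, [0]), (3, [0, 2, 6]), (2, [3, 5]), (5, [2, 4]), (4, [5]), (6, [3]), (7,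
     [0])], []⟩, 6, 9, .witness [(6, 1)], .embed 0 [0, 1, 3, 2, 5, 4, 6, 7, 9], [.embed 64 [0, 1,
     6, 3], .witness [(3, -1), (5, 1)], .embed 64 [0, 3, 6, 7]]⟩,
   ⟨⟨[(0, [1, 3]), (1, [0]), (3, [0, 2, 6]), (2, [3, 5]), (5, [2, 4]), (4, [5]), (6, [3])], []⟩,
     0, 7, .embed 66 [0, 3, 1, 2], .embed 0 [0, 7, 3, 2, 5, 4, 6, 1], [.witness [(3, -1), (5,
     1)]]⟩,
   ⟨⟨[(0, [1, 3]), (1, [0]), (3, [0, 2]), (2, [3, 5]), (5, [2, 4]), (4, [5])], []⟩, 3, 6, .embed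
     67 [3, 0, 2, 1], .embed 0 [0, 1, 3, 2, 5, 4, 6], [.embed 66 [3, 4, 5, 2]]⟩,
   ⟨⟨[(0, [1, 3]), (1, [0]), (3, [0, 2]), (2, [3, 5]), (5, [2])], []⟩, 1, 4, .witness [(1, 1)],
     .embed 0 [1, 4, 0, 3, 2, 5], [.embed 67 [0, 1, 2, 3]]⟩,
   ⟨⟨[(0, [1, 3]), (1, [0]), (3, [0, 2]), (2, [3])], []⟩, 1, 4, .witness [(1, 1)], .embed 0 [1, 4,
     0, 3, 2], [.embed 68 [0, 1, 2, 3]]⟩,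
   ⟨⟨[(0, [1, 3]), (1, [0]), (3, [0])], []⟩, 1, 2, .witness [(1, 1)], .embed 0 [0, 3, 1, 2], []⟩,
   ⟨⟨[(0, [1]), (1, [0])], []⟩, 0, 3, .witness [(0, 1)], .embed 0 [0, 3, 1], []⟩,
   ⟨⟨[(0, [])], []⟩, 0, 1, .witness [(0, 1)], .embed 0 [1, 0], []⟩]

theorem checkSteps_certificate : checkSteps [heawood] certificate = true := by
  decide +kernel

end Pattern

/-! ### Occurrences of the Heawood pattern are components -/

namespace Pattern

/-- The label of a vertex of the Heawood graph. -/
def heawoodLabel : ZMod 7 ⊕ ZMod 7 → ℕ :=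
  Sum.elim (fun p => 2 * p.val) (fun l => 2 * l.val + 1)

theorem heawoodLabel_injective : Function.Injective heawoodLabel := by
  unfold Function.Injective
  decide +kernel

theorem heawoodLabel_mem_verts : ∀ a, heawoodLabel a ∈ heawood.verts := by
  decide +kernel

theorem isFull_heawoodLabel : ∀ a, heawood.isFull (heawoodLabel a) = true := by
  decide +kernel

theorem exists_eq_heawoodLabel :
    ∀ a, ∀ j ∈ heawood.nbrs (heawoodLabel a), ∃ b, j = heawoodLabel b := by
  decide +kernel

theorem heawoodGraph_adj_iff (a b : ZMod 7 ⊕ ZMod 7) :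
    heawoodGraph.Adj a b ↔ heawoodLabel b ∈ heawood.nbrs (heawoodLabel a) := by
  rcases a with p | l <;> rcases b with q | m
  · change False ↔ _
    revert p q
    decide +kernel
  · change FanoIncident p m ↔ _
    revert p m
    decide +kernel
  · change FanoIncident q l ↔ _
    revert q l
    decide +kernel
  · change False ↔ _
    revert l m
    decide +kernel

/-- Any two points lie on a common line, so they are joined by a path of length two; each line
contains a point. -/
theorem heawoodGraph_reachable (b : ZMod 7 ⊕ ZMod 7) :
    heawoodGraph.Reachable (Sum.inl 0) b := by
  have hinl : ∀ q : ZMod 7, heawoodGraph.Reachable (Sum.inl 0) (Sum.inl q) := by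
    intro q
    by_cases hq : q = 0
    · rw [hq]
    · obtain ⟨l, ⟨h0, hl⟩, -⟩ := fano_existsUnique_line 0 q (Ne.symm hq)
      have h1 : heawoodGraph.Adj (Sum.inl 0) (Sum.inr l) := h0
      have h2 : heawoodGraph.Adj (Sum.inr l) (Sum.inl q) := hl
      exact h1.reachable.trans h2.reachable
  rcases b with q | l
  · exact hinl q
  · have h : heawoodGraph.Adj (Sum.inl l) (Sum.inr l) := Or.inl rfl
    exact (hinl l).trans h.reachable

section

variable {V : Type*} [Fintype V] {G : SimpleGraph V} [DecidableRel G.Adj] {col : V → Bool}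

/-- The Heawood graph is cubic, so in a subcubic graph no edge leaves an occurrence or is added
inside it. A connected set closed under adjacency is a whole component. -/
theorem Realizes.nonempty_iso_heawoodGraph (hd : G.maxDegree ≤ 3) {B : Set V} {ρ : ℕ → V}
    (hρ : Realizes G col B heawood ρ) :
    ∃ C : G.ConnectedComponent, Nonempty (C.toSimpleGraph ≃g heawoodGraph) := by
  set φ : ZMod 7 ⊕ ZMod 7 → V := fun a => ρ (heawoodLabel a) with hφ
  have hinj : Function.Injective φ := fun a b hab => heawoodLabel_injective
    (hρ.inj _ (heawoodLabel_mem_verts a) _ (heawoodLabel_mem_verts b) hab)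
  have hadj : ∀ {a b}, heawoodGraph.Adj a b → G.Adj (φ a) (φ b) := fun {a b} hab =>
    hρ.adj _ _ ((heawoodGraph_adj_iff a b).mp hab)
  have hclosed : ∀ a w, G.Adj (φ a) w → ∃ b, heawoodGraph.Adj a b ∧ w = φ b := by
    intro a w haw
    obtain ⟨j, hj, rfl⟩ := hρ.exists_of_isFull hd (isFull_heawoodLabel a) haw
    obtain ⟨b, rfl⟩ := exists_eq_heawoodLabel a j hj
    exact ⟨b, (heawoodGraph_adj_iff a b).mpr hj, rfl⟩
  have hrange : ∀ {u w : V}, G.Walk u w → (∃ a, u = φ a) → ∃ b, w = φ b := by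
    intro u w p
    induction p with
    | nil => exact id
    | cons h _ ih =>
      rintro ⟨a, rfl⟩
      obtain ⟨b, -, rfl⟩ := hclosed a _ h
      exact ih ⟨b, rfl⟩
  let f : heawoodGraph →g G := ⟨φ, hadj⟩
  have hmem : ∀ b, φ b ∈ G.connectedComponentMk (φ (Sum.inl 0)) := fun b =>
    SimpleGraph.ConnectedComponent.sound ((heawoodGraph_reachable b).map f).symm
  refine ⟨G.connectedComponentMk (φ (Sum.inl 0)), ⟨SimpleGraph.Iso.symm
    ⟨Equiv.ofBijective (fun b => ⟨φ b, hmem b⟩) ⟨?_, ?_⟩, ?_⟩⟩⟩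
  · exact fun a b hab => hinj (congrArg Subtype.val hab)
  · rintro ⟨w, hw⟩
    obtain ⟨p⟩ := (SimpleGraph.ConnectedComponent.exact hw).symm
    obtain ⟨b, rfl⟩ := hrange p ⟨_, rfl⟩
    exact ⟨b, rfl⟩
  · intro a b
    change G.Adj (φ a) (φ b) ↔ heawoodGraph.Adj a b
    refine ⟨fun h => ?_, hadj⟩
    obtain ⟨c, hc, hbc⟩ := hclosed a _ h
    rwa [hinj hbc]

/-- In a subcubic bipartite graph without Heawood components, the adjacency operator is not
expanding on any ball of a certain radius. -/
theorem not_expandsOn_walkBall (hd : G.maxDegree ≤ 3) (hcol : ∀ v w, G.Adj v w → col v ≠ col w)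
    (hH : ∀ C : G.ConnectedComponent, IsEmpty (C.toSimpleGraph ≃g heawoodGraph)) (v : V) :
    ¬ ExpandsOn G (walkBall G certificate.length v) := by
  -- The base of the search: the Heawood pattern is excluded by the hypothesis on components, at no
  -- cost of radius.
  have hL : ∀ P ∈ [heawood], P.wellFormed = true ∧ Refuted G col P 0 := by
    intro P hP
    rw [List.mem_singleton] at hP
    subst hP
    refine ⟨by decide +kernel, fun v r _ ρ hρ => ?_⟩
    obtain ⟨C, ⟨e⟩⟩ := hρ.nonempty_iso_heawoodGraph hd
    exact (hH C).false e
  -- The last refuted pattern is a single vertex without recorded neighbours. It occurs in the ball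
  -- of radius `0` around every `v`, so its refutation is the claim.
  have hlast : certificate.getLast?.map Step.pattern = some ⟨[(0, [])], []⟩ := rfl
  obtain ⟨E, hE, hEp⟩ := Option.map_eq_some_iff.mp hlast
  have hR := refuted_of_checkSteps hd hcol hL checkSteps_certificate E
    (List.mem_of_getLast? hE)
  rw [hEp] at hR
  intro hexp
  have hverts : (⟨[(0, [])], []⟩ : Pattern).verts = [0] := rfl
  have hnbrs : ∀ i, (⟨[(0, [])], []⟩ : Pattern).nbrs i = [] := by
    intro i
    rw [nbrs, assocGet, foldList_cons, foldList_nil, Bool.cond_self]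
  refine hR v 0 (by simpa using hexp) (fun _ => v) ⟨?_, ?_, ?_, ?_, ?_, ?_, ?_, ?_⟩
  · simp [hverts]
  · simp [hnbrs]
  · simp
  · simp [hverts]
  · simp [hverts, self_mem_walkBall]
  · simp [hnbrs]
  · simp [hverts]
  · simp

end

end Pattern

/-! ### The main theorem -/

theorem theorem3 :
    ∃ δ : ℝ, 0 < δ ∧
      ∀ (V : Type*) [Fintype V] [DecidableEq V] (G : SimpleGraph V) [DecidableRel G.Adj],
        G.IsBipartite →
        G.maxDegree ≤ 3 →
        (∀ C : G.ConnectedComponent, IsEmpty (C.toSimpleGraph ≃g heawoodGraph)) →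
        ∀ i : Fin (Fintype.card V),
          (1 / 2 - δ) * (Fintype.card V : ℝ) ≤ ((i : ℕ) : ℝ) + 1 →
          ((i : ℕ) : ℝ) + 1 ≤ (1 / 2 + δ) * (Fintype.card V : ℝ) →
          adjEigenvalue G i ∈ Set.Icc (-1 : ℝ) 1 := by
  -- The radius `R` of the local claim is the number of steps of the certificate, and `δ = 1 / 4 ^
  -- (2 * R + 4)`.
  refine ⟨1 / 4 ^ (2 * Pattern.certificate.length + 4), by positivity, ?_⟩
  intro V _ _ G _ hb hd hH i h₁ h₂
  refine adjEigenvalue_mem_Icc hb hd (fun v => ?_) i h₁ h₂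
  obtain ⟨c⟩ := id hb
  refine Pattern.not_expandsOn_walkBall (col := fun v => decide (c v = 0)) hd ?_ hH v
  intro v w hvw h
  have hne := c.valid hvw
  rw [decide_eq_decide] at h
  omega
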